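/- Let two discs with centres $A$ and $B$ and radius sum $s>0$ move in an obstacle-free plane. A placement $P=(A,B)\in\mathbb R^2\times\mathbb R^2$ is compatible if $\|A-B\|\ge s$. A motion from $P_0=(A_0,B_0)$ to $P_1=(A_1,B_1)$ is a pair $(\xi_A,\xi_B)$ of continuous rectifiable curves $\xi_A,\xi_B:[0,1]\to\mathbb R^2$ from $A_0$ to $A_1$ and from $B_0$ to $B_1$, respectively; it is compatible (collision-free) if $\|\xi_A(t)-\xi_B(t)\|\ge s$ for all $t\in[0,1]$. Its length is $\ell(\xi_A)+\ell(\xi_B)$, the sum of the arc lengths of the two curves. Theorem 4.1. Let $P_0$ and $P_1$ be arbitrary compatible placements. Then there is a shortest motion from $P_0$ to $P_1$, that is, a compatible motion whose length is minimal among all compatible motions from $P_0$ to $P_1$, such that each of the two trajectories $\xi_A$ and $\xi_B$ is composed of at most six pieces, each a straight segment or an arc of a circle of radius $s$. Moreover, the motion can be chosen decoupled: $[0,1]$ splits into finitely many intervals during each of which at most one of the two discs moves. -/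

import Mathlib

open scoped unitInterval ENNReal

noncomputable section

namespace TwoDiscs

/-- The Euclidean plane. -/
abbrev Plane : Type := EuclideanSpace ℝ (Fin 2)

/-- A placement of the disc pair: the positions of the two centres. -/
structure Placement where
  A : Plane
  B : Plane

/-- A placement is compatible if the two open discs, of radius sum `s`, do not overlap. -/
def Placement.Compatible (s : ℝ) (P : Placement) : Prop :=
  s ≤ dist P.A P.B

/-- A trajectory: a continuous rectifiable curve, parametrized by `[0, 1]`, from `p` to `q`. -/
structure Trajectory (p q : Plane) where
  toPath : Path p q
  rectifiable : BoundedVariationOn toPath Set.univ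

/-- The length of a trajectory: the supremum over all finite subdivisions of `[0, 1]` of the
sum of the distances between consecutive points. -/
def Trajectory.length {p q : Plane} (ξ : Trajectory p q) : ℝ≥0∞ :=
  eVariationOn ξ.toPath Set.univ

/-- A coordinated motion of the disc pair from the placement `P₀` to the placement `P₁`. -/
structure Motion (P₀ P₁ : Placement) where
  trajA : Trajectory P₀.A P₁.A
  trajB : Trajectory P₀.B P₁.B

/-- The placement of the disc pair at time `t`. -/
def Motion.placementAt {P₀ P₁ : Placement} (m : Motion P₀ P₁) (t : I) : Placement :=
  ⟨m.trajA.toPath t, m.trajB.toPath t⟩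

/-- A motion is compatible (collision-free) if all of its placements are. -/
def Motion.Compatible (s : ℝ) {P₀ P₁ : Placement} (m : Motion P₀ P₁) : Prop :=
  ∀ t : I, (m.placementAt t).Compatible s

/-- The length of a motion: the total length of the two trajectories. -/
def Motion.length {P₀ P₁ : Placement} (m : Motion P₀ P₁) : ℝ≥0∞ :=
  m.trajA.length + m.trajB.length

/-- A shortest motion: a compatible motion of minimum length among all compatible motions between
the same two placements. -/
def Motion.IsShortest (s : ℝ) {P₀ P₁ : Placement} (m : Motion P₀ P₁) : Prop :=
  m.Compatible s ∧ ∀ m' : Motion P₀ P₁, m'.Compatible s → m.length ≤ m'.length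

/-- During the time interval `[a, b]` the curve `γ` traverses, without backtracking (but possibly
pausing), the straight segment from `γ a` to `γ b`. -/
def TraversesSegment (γ : I → Plane) (a b : I) : Prop :=
  ∃ φ : I → ℝ, MonotoneOn φ (Set.Icc a b) ∧
    ∀ t ∈ Set.Icc a b, γ t = AffineMap.lineMap (γ a) (γ b) (φ t)

/-- During the time interval `[a, b]` the curve `γ` traverses, without backtracking (but possibly
pausing), an arc of a circle of radius `s`; `φ t` is the polar angle about the centre `c`, and
the arc may be traversed counter-clockwise or clockwise, at most once around. -/
def TraversesArc (s : ℝ) (γ : I → Plane) (a b : I) : Prop :=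
  ∃ (c : Plane) (φ : I → ℝ), ContinuousOn φ (Set.Icc a b) ∧
    (MonotoneOn φ (Set.Icc a b) ∨ AntitoneOn φ (Set.Icc a b)) ∧
    |φ b - φ a| ≤ 2 * Real.pi ∧
    ∀ t ∈ Set.Icc a b, γ t = c + s • !₂[Real.cos (φ t), Real.sin (φ t)]

/-- `τ` is a subdivision `0 = τ 0 ≤ τ 1 ≤ ⋯ ≤ τ n = 1` of the unit interval. -/
def IsSubdivision {n : ℕ} (τ : Fin (n + 1) → I) : Prop :=
  Monotone τ ∧ τ 0 = 0 ∧ τ (Fin.last n) = 1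

/-- The trajectory is composed of at most `N` pieces, each of which is a straight segment or an
arc of a circle of radius `s`. -/
def Trajectory.ComposedOfAtMost (s : ℝ) (N : ℕ) {p q : Plane} (ξ : Trajectory p q) : Prop :=
  ∃ n ≤ N, ∃ τ : Fin (n + 1) → I, IsSubdivision τ ∧
    ∀ i : Fin n, TraversesSegment ξ.toPath (τ i.castSucc) (τ i.succ) ∨
      TraversesArc s ξ.toPath (τ i.castSucc) (τ i.succ)

/-- During the time interval `[a, b]` the curve `γ` does not move. -/
def AtRest (γ : I → Plane) (a b : I) : Prop :=
  ∀ t ∈ Set.Icc a b, γ t = γ a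

/-- A motion is decoupled if the unit interval splits into finitely many time intervals during
each of which at most one of the two discs moves. -/
def Motion.Decoupled {P₀ P₁ : Placement} (m : Motion P₀ P₁) : Prop :=
  ∃ (n : ℕ) (τ : Fin (n + 1) → I), IsSubdivision τ ∧
    ∀ i : Fin n, AtRest m.trajA.toPath (τ i.castSucc) (τ i.succ) ∨
      AtRest m.trajB.toPath (τ i.castSucc) (τ i.succ)

end TwoDiscs

end

open scoped unitInterval ENNReal

noncomputable section

namespace TwoDiscs

open Real Set

/-! Put a = A₁ - A₀ and b = B₀ - B₁. The curves ξ_A and -ξ_B have net displacements a and b. Up to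
this choice of sign their sum is the difference vector, which runs from P = A₀ - B₀ to Q = P + a + b
outside the open disc of radius s about the origin. Since it avoids the origin, it turns through all
directions between those of P and Q, counter-clockwise or clockwise (`turns_through`).

Lower bound. In the manner of Cauchy and Crofton, the length of a curve is at least half the
integral, over a half turn of directions, of twice its width minus the width of the chord between
its ends. When the difference vector points in direction θ it has height at least s there, so the
two curves together must reach beyond their chords by at least `excess`, the amount by which the
disc protrudes beyond the parallelogram P, P + a, P + b, Q. Integrating, a motion that turns through
[x, y] has length at least ‖a‖ + ‖b‖ + ∫ excess (`add_integral_excess_le`).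

Upper bound. `Schedule.exists` provides one decoupled motion that is no longer than the bound for
either way of turning, hence a shortest one. Let x be the last direction in which P still has height
s, and y the first one in which Q has. If these ranges overlap, straight moves through a corner of
the parallelogram suffice. Otherwise the shape of the parallelogram decides. If a corner protrudes
suitably beyond the disc, the discs move one after the other along geodesics through that corner
(`Schedule.geodesic_corner`). If no corner protrudes, the geodesic from P to Q has a chord equal to
a or b, and the part it cuts off is given to one disc, the rest to the other (`Schedule.split`). If
the two corners protrude at opposite ends, one disc steps aside and later completes its move
(`Schedule.detour`).

A turn by more than π either costs at least as much as the smaller turn (`integral_excess_le`), or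
one end point lies so far behind the other that the same constructions work (`Schedule.of_arc`).
Each of the three phases is at most tangent, arc, tangent. One disc moves in the two outer phases,
whence six pieces. -/

/-- The unit vector at polar angle `θ`. -/
def uvec (θ : ℝ) : Plane := !₂[cos θ, sin θ]

/-- The unit vector at polar angle `θ + π / 2`. -/
def tvec (θ : ℝ) : Plane := !₂[-sin θ, cos θ]

/-- The component of `X` in the direction `uvec θ`. -/
def hdot (X : Plane) (θ : ℝ) : ℝ := X 0 * cos θ + X 1 * sin θ

/-- The component of `X` in the direction `tvec θ`. -/
def vdot (X : Plane) (θ : ℝ) : ℝ := -X 0 * sin θ + X 1 * cos θ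

/-! ### Components of a vector in a rotating orthonormal frame. -/

section Components

variable (X Y : Plane) (r θ x y : ℝ)

@[simp] lemma uvec_zero_apply : uvec θ 0 = cos θ := rfl
@[simp] lemma uvec_one_apply : uvec θ 1 = sin θ := rfl
@[simp] lemma tvec_zero_apply : tvec θ 0 = -sin θ := rfl
@[simp] lemma tvec_one_apply : tvec θ 1 = cos θ := rfl

@[simp] lemma hdot_add : hdot (X + Y) θ = hdot X θ + hdot Y θ := by simp [hdot]; ring
@[simp] lemma hdot_sub : hdot (X - Y) θ = hdot X θ - hdot Y θ := by simp [hdot]; ring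
@[simp] lemma hdot_neg : hdot (-X) θ = -hdot X θ := by simp [hdot]; ring
@[simp] lemma hdot_smul : hdot (r • X) θ = r * hdot X θ := by simp [hdot]; ring
@[simp] lemma hdot_zero : hdot 0 θ = 0 := by simp [hdot]
@[simp] lemma vdot_add : vdot (X + Y) θ = vdot X θ + vdot Y θ := by simp [vdot]; ring
@[simp] lemma vdot_sub : vdot (X - Y) θ = vdot X θ - vdot Y θ := by simp [vdot]; ring
@[simp] lemma vdot_smul : vdot (r • X) θ = r * vdot X θ := by simp [vdot]; ring

lemma hdot_uvec : hdot (uvec x) y = cos (y - x) := by simp [hdot, cos_sub]; ring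
lemma vdot_uvec : vdot (uvec x) y = -sin (y - x) := by simp [vdot, sin_sub]; ring
lemma hdot_tvec : hdot (tvec x) y = sin (y - x) := by simp [hdot, sin_sub]; ring
lemma vdot_tvec : vdot (tvec x) y = cos (y - x) := by simp [vdot, cos_sub]; ring
@[simp] lemma hdot_uvec_self : hdot (uvec x) x = 1 := by simp [hdot_uvec]
@[simp] lemma vdot_uvec_self : vdot (uvec x) x = 0 := by simp [vdot_uvec]
@[simp] lemma hdot_tvec_self : hdot (tvec x) x = 0 := by simp [hdot_tvec]
@[simp] lemma vdot_tvec_self : vdot (tvec x) x = 1 := by simp [vdot_tvec]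

lemma hdot_rotate : hdot X y = hdot X x * cos (y - x) + vdot X x * sin (y - x) := by
  simp only [hdot, vdot, cos_sub, sin_sub]
  linear_combination (-(X 0 * cos y + X 1 * sin y)) * (sin_sq_add_cos_sq x)

lemma vdot_rotate : vdot X y = vdot X x * cos (y - x) - hdot X x * sin (y - x) := by
  simp only [hdot, vdot, cos_sub, sin_sub]
  linear_combination (-(-X 0 * sin y + X 1 * cos y)) * (sin_sq_add_cos_sq x)

lemma hdot_add_pi : hdot X (θ + π) = -hdot X θ := by simp [hdot]; ring
lemma hdot_sub_pi : hdot X (θ - π) = -hdot X θ := by simp [hdot]; ring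
lemma hdot_add_two_pi : hdot X (θ + 2 * π) = hdot X θ := by simp [hdot]

lemma norm_sq_eq : ‖X‖ ^ 2 = X 0 ^ 2 + X 1 ^ 2 := by
  simp [EuclideanSpace.norm_sq_eq, Fin.sum_univ_two]

lemma norm_sq_eq_dots : ‖X‖ ^ 2 = hdot X θ ^ 2 + vdot X θ ^ 2 := by
  rw [norm_sq_eq, hdot, vdot]
  linear_combination (-(X 0 ^ 2 + X 1 ^ 2)) * (sin_sq_add_cos_sq θ)

lemma abs_hdot_le : |hdot X θ| ≤ ‖X‖ :=
  abs_le_of_sq_le_sq (by nlinarith [norm_sq_eq_dots X θ, sq_nonneg (vdot X θ)]) (norm_nonneg _)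

lemma hdot_le : hdot X θ ≤ ‖X‖ := (le_abs_self _).trans (abs_hdot_le X θ)

lemma abs_vdot_le : |vdot X θ| ≤ ‖X‖ :=
  abs_le_of_sq_le_sq (by nlinarith [norm_sq_eq_dots X θ, sq_nonneg (hdot X θ)]) (norm_nonneg _)

@[simp] lemma norm_uvec : ‖uvec θ‖ = 1 := by
  have := norm_sq_eq_dots (uvec θ) θ
  simp at this
  rcases this with h | h
  · exact h
  · linarith [norm_nonneg (uvec θ)]

@[simp] lemma norm_tvec : ‖tvec θ‖ = 1 := by
  have := norm_sq_eq_dots (tvec θ) θ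
  simp at this
  rcases this with h | h
  · exact h
  · linarith [norm_nonneg (tvec θ)]

lemma plane_ext {X Y : Plane} (h0 : X 0 = Y 0) (h1 : X 1 = Y 1) : X = Y := by
  ext i; fin_cases i <;> assumption

lemma eq_dots : X = hdot X θ • uvec θ + vdot X θ • tvec θ := by
  apply plane_ext
  · simp [hdot, vdot]; linear_combination (-(X 0)) * (sin_sq_add_cos_sq θ)
  · simp [hdot, vdot]; linear_combination (-(X 1)) * (sin_sq_add_cos_sq θ)

lemma ext_dots {X Y : Plane} (h : hdot X θ = hdot Y θ) (v : vdot X θ = vdot Y θ) : X = Y := by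
  rw [eq_dots X θ, eq_dots Y θ, h, v]

/-- Two different directions determine a vector. -/
lemma ext_hdot {X Y : Plane} (hxy : sin (y - x) ≠ 0) (hx : hdot X x = hdot Y x)
    (hy : hdot X y = hdot Y y) : X = Y := by
  apply ext_dots x hx
  rw [hdot_rotate X x y, hdot_rotate Y x y, hx] at hy
  exact mul_right_cancel₀ hxy (add_left_cancel hy)

end Components

/-! ### Directional components as functions of the angle; polar angles. -/

lemma continuous_uvec : Continuous uvec := by
  unfold uvec; fun_prop

lemma continuous_hdot (X : Plane) : Continuous (hdot X) := by
  unfold hdot; fun_prop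

lemma continuous_hdot_uncurry : Continuous fun z : Plane × ℝ => hdot z.1 z.2 := by
  unfold hdot; fun_prop

lemma hasDerivAt_hdot (X : Plane) (θ : ℝ) : HasDerivAt (hdot X) (vdot X θ) θ := by
  unfold hdot vdot
  exact (((hasDerivAt_cos θ).const_mul (X 0)).add ((hasDerivAt_sin θ).const_mul (X 1))).congr_deriv
    (by ring)

lemma hasDerivAt_vdot (X : Plane) (θ : ℝ) : HasDerivAt (vdot X) (-hdot X θ) θ := by
  unfold hdot vdot
  exact (((hasDerivAt_sin θ).const_mul (-X 0)).add ((hasDerivAt_cos θ).const_mul (X 1))).congr_deriv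
    (by ring)

lemma integral_hdot (X : Plane) (x y : ℝ) : ∫ θ in x..y, hdot X θ = vdot X x - vdot X y := by
  have h := intervalIntegral.integral_eq_sub_of_hasDerivAt (a := x) (b := y)
    (f := fun θ => -vdot X θ) (f' := hdot X)
    (fun θ _ => neg_neg (hdot X θ) ▸ (hasDerivAt_vdot X θ).neg)
    ((continuous_hdot X).intervalIntegrable _ _)
  rw [h]; ring

/-- Every vector has a polar angle in any given half-open interval of length `2 * π`. -/
lemma exists_polar (X : Plane) (x : ℝ) : ∃ θ, x ≤ θ ∧ θ < x + 2 * π ∧ X = ‖X‖ • uvec θ := by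
  have key : ∃ θ, X = ‖X‖ • uvec θ := by
    set z : ℂ := ⟨X 0, X 1⟩ with hz
    have hn : ‖z‖ = ‖X‖ := by
      have h1 : ‖z‖ ^ 2 = ‖X‖ ^ 2 := by
        rw [norm_sq_eq, ← Complex.normSq_eq_norm_sq, Complex.normSq_apply]; ring
      exact (pow_left_inj₀ (norm_nonneg _) (norm_nonneg _) two_ne_zero).1 h1
    refine ⟨z.arg, plane_ext ?_ ?_⟩
    · simpa [hn] using (Complex.norm_mul_cos_arg z).symm
    · simpa [hn] using (Complex.norm_mul_sin_arg z).symm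
  obtain ⟨θ, hθ⟩ := key
  refine ⟨toIcoMod two_pi_pos x θ, (toIcoMod_mem_Ico two_pi_pos x θ).1,
    (toIcoMod_mem_Ico two_pi_pos x θ).2, ?_⟩
  rw [hθ]
  have : uvec (toIcoMod two_pi_pos x θ) = uvec θ := by
    rw [toIcoMod, uvec, uvec, zsmul_eq_mul, cos_sub_int_mul_two_pi, sin_sub_int_mul_two_pi]
  rw [this]; simp [norm_smul]

lemma exists_polar_tvec (X : Plane) (x : ℝ) :
    ∃ n, x ≤ n ∧ n < x + 2 * π ∧ X = ‖X‖ • tvec n := by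
  obtain ⟨θ, h1, h2, h3⟩ := exists_polar X (x + π / 2)
  refine ⟨θ - π / 2, by linarith, by linarith, ?_⟩
  convert h3 using 2
  apply plane_ext <;> simp [sin_sub_pi_div_two, cos_sub_pi_div_two]

/-- A vector whose component changes from nonpositive to nonnegative is tangential in between. -/
lemma exists_tangential {Z : Plane} {x y : ℝ} (hxy : x < y)
    (h1 : hdot Z x ≤ 0) (h2 : 0 ≤ hdot Z y) : ∃ n, x ≤ n ∧ n ≤ y ∧ Z = ‖Z‖ • tvec n := by
  by_cases hZ : Z = 0
  · exact ⟨x, le_rfl, hxy.le, by simp [hZ]⟩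
  have hZ' : 0 < ‖Z‖ := norm_pos_iff.2 hZ
  obtain ⟨n, hn1, hn2, hn⟩ := exists_polar_tvec Z x
  refine ⟨n, hn1, ?_, hn⟩
  rw [hn, hdot_smul, hdot_tvec] at h1 h2
  have s1 : 0 ≤ sin (n - x) := by
    have : sin (x - n) ≤ 0 := by
      by_contra! h; linarith [mul_pos hZ' h]
    rw [← neg_sub, sin_neg] at this; linarith
  have s2 : 0 ≤ sin (y - n) := nonneg_of_mul_nonneg_right (by linarith) hZ'
  have hnx : n ≤ x + π := by
    by_contra! h
    have := sin_neg_of_neg_of_neg_pi_lt (x := n - x - 2 * π) (by linarith) (by linarith)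
    rw [sin_sub_two_pi] at this; linarith
  by_contra! h
  have := sin_neg_of_neg_of_neg_pi_lt (x := y - n) (by linarith) (by linarith)
  linarith

/-- `Z` is tangential at some `n` in `[x, y]`, so its component is ‖Z‖ sin (θ - n): the positive
part vanishes before `n` and integrates to ‖Z‖ - `vdot Z y` after it. Only the degenerate interval
needs the inequality. -/
lemma integral_posPart_hdot_le {Z : Plane} {x y : ℝ} (hxy : x ≤ y) (hy : y ≤ x + π)
    (h1 : hdot Z x ≤ 0) (h2 : 0 ≤ hdot Z y) :
    ∫ θ in x..y, max (hdot Z θ) 0 ≤ ‖Z‖ - vdot Z y := by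
  rcases hxy.eq_or_lt with rfl | hxy
  · simp; linarith [le_of_abs_le (abs_vdot_le Z x)]
  obtain ⟨n, hn1, hn2, hn⟩ := exists_tangential hxy h1 h2
  have hi : ∀ c d, IntervalIntegrable (fun θ => max (hdot Z θ) 0) MeasureTheory.volume c d :=
    fun c d => ((continuous_hdot Z).max continuous_const).intervalIntegrable _ _
  rw [← intervalIntegral.integral_add_adjacent_intervals (hi x n) (hi n y)]
  have e1 : ∫ θ in x..n, max (hdot Z θ) 0 = ∫ θ in x..n, (0 : ℝ) := by
    apply intervalIntegral.integral_congr
    intro θ hθ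
    rw [Set.uIcc_of_le hn1] at hθ
    apply max_eq_right
    rw [hn, hdot_smul, hdot_tvec]
    exact mul_nonpos_of_nonneg_of_nonpos (norm_nonneg _)
      (sin_nonpos_of_nonpos_of_neg_pi_le (by linarith [hθ.2]) (by linarith [hθ.1]))
  have e2 : ∫ θ in n..y, max (hdot Z θ) 0 = ∫ θ in n..y, hdot Z θ := by
    apply intervalIntegral.integral_congr
    intro θ hθ
    rw [Set.uIcc_of_le hn2] at hθ
    apply max_eq_left
    rw [hn, hdot_smul, hdot_tvec]
    exact mul_nonneg (norm_nonneg _)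
      (sin_nonneg_of_nonneg_of_le_pi (by linarith [hθ.1]) (by linarith [hθ.2]))
  have e3 : vdot Z n = ‖Z‖ := by
    conv_lhs => rw [hn]
    simp
  rw [e1, e2, integral_hdot, e3]; simp

/-- A component that is nonpositive at both ends of an interval of length less than `π` is
nonpositive in between. -/
lemma hdot_nonpos_between {Z : Plane} {x y t : ℝ} (hxt : x ≤ t) (hty : t ≤ y)
    (hxy : y < x + π) (h1 : hdot Z x ≤ 0) (h2 : hdot Z y ≤ 0) : hdot Z t ≤ 0 := by
  rcases hxt.eq_or_lt with rfl | hxt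
  · exact h1
  -- Up to the positive factor sin (y - x), `uvec t` is a nonnegative combination of `uvec x` and
  -- `uvec y`.
  have key : hdot Z t * sin (y - x) = hdot Z x * sin (y - t) + hdot Z y * sin (t - x) := by
    rw [hdot_rotate Z x t, hdot_rotate Z x y]
    have : y - t = (y - x) - (t - x) := by ring
    rw [this, sin_sub (y - x) (t - x)]; ring
  have a1 : 0 < sin (y - x) := sin_pos_of_pos_of_lt_pi (by linarith) (by linarith)
  have a2 : 0 ≤ sin (y - t) := sin_nonneg_of_nonneg_of_le_pi (by linarith) (by linarith)
  have a3 : 0 ≤ sin (t - x) := sin_nonneg_of_nonneg_of_le_pi (by linarith) (by linarith)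
  by_contra! h
  nlinarith [mul_pos h a1, mul_nonneg (neg_nonneg.2 h1) a2, mul_nonneg (neg_nonneg.2 h2) a3]

/-! ### Chains of segments and arcs under translation, reflection, reparametrization and reversal.
-/

/-- During `[a, b]` the curve traverses a segment or an arc of a circle of radius `s`. -/
def Piece (s : ℝ) (γ : I → Plane) (a b : I) : Prop :=
  TraversesSegment γ a b ∨ TraversesArc s γ a b

/-- During `[a, b]` the curve traverses `n` consecutive segments or arcs of radius `s`. -/
inductive Pieces (s : ℝ) (γ : I → Plane) : ℕ → I → I → Prop
  | single {a b : I} : a ≤ b → Piece s γ a b → Pieces s γ 1 a b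
  | snoc {n : ℕ} {a b c : I} : Pieces s γ n a b → b ≤ c → Piece s γ b c → Pieces s γ (n + 1) a c

section Pieces

variable {s : ℝ} {γ γ' : I → Plane} {n k : ℕ} {a b c : I}

lemma Pieces.le (h : Pieces s γ n a b) : a ≤ b := by
  induction h with
  | single h _ => exact h
  | snoc _ h _ ih => exact ih.trans h

lemma Pieces.append (h : Pieces s γ n a b) (h' : Pieces s γ k b c) : Pieces s γ (n + k) a c := by
  induction h' with
  | single hbc hp => exact h.snoc hbc hp
  | snoc _ hbc hp ih => exact (ih h).snoc hbc hp

lemma Pieces.exists_subdivision (h : Pieces s γ n a b) :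
    ∃ τ : Fin (n + 1) → I, Monotone τ ∧ τ 0 = a ∧ τ (Fin.last n) = b ∧
      ∀ i : Fin n, Piece s γ (τ i.castSucc) (τ i.succ) := by
  induction h with
  | @single a b hab hp =>
    refine ⟨![a, b], ?_, rfl, rfl, ?_⟩
    · rw [Fin.monotone_iff_le_succ]
      intro i; fin_cases i; exact hab
    · intro i; fin_cases i; exact hp
  | @snoc n a b c _ hbc hp ih =>
    obtain ⟨τ, hm, h0, h1, hτ⟩ := ih
    refine ⟨Fin.snoc τ c, ?_, ?_, by simp, ?_⟩
    · rw [Fin.monotone_iff_le_succ]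
      intro i
      induction i using Fin.lastCases with
      | last =>
        rw [Fin.succ_last, Fin.snoc_last, Fin.snoc_castSucc, h1]; exact hbc
      | cast j =>
        rw [Fin.snoc_castSucc, Fin.succ_castSucc, Fin.snoc_castSucc]
        exact hm (Fin.castSucc_le_succ j)
    · rw [← Fin.castSucc_zero, Fin.snoc_castSucc, h0]
    · intro i
      induction i using Fin.lastCases with
      | last =>
        rw [Fin.succ_last, Fin.snoc_last, Fin.snoc_castSucc, h1]; exact hp
      | cast j =>
        rw [Fin.snoc_castSucc, Fin.succ_castSucc, Fin.snoc_castSucc]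
        exact hτ j

/-- The sign is needed because the second disc moves by the negative of its contribution to the
difference vector. On an arc, the point reflection is absorbed by adding π to the polar angle. -/
lemma Piece.transform {ε : ℝ} (hε : ε = 1 ∨ ε = -1) {w : Plane} {m : I → I} (hm : Monotone m)
    (hc : Continuous m) {a' b' : I} (hab : a' ≤ b') (ha : m a' = a) (hb : m b' = b)
    (hγ : ∀ t ∈ Icc a' b', γ' t = ε • γ (m t) + w) (h : Piece s γ a b) : Piece s γ' a' b' := by
  have hmaps : MapsTo m (Icc a' b') (Icc a b) := fun t ht =>
    ⟨ha ▸ hm ht.1, hb ▸ hm ht.2⟩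
  rcases h with ⟨φ, hφ, h⟩ | ⟨z, φ, hφc, hφm, hle, h⟩
  · refine Or.inl ⟨φ ∘ m, hφ.comp (hm.monotoneOn _) hmaps, fun t ht => ?_⟩
    rw [hγ t ht, hγ a' (left_mem_Icc.2 hab), hγ b' (right_mem_Icc.2 hab), h _ (hmaps ht), ha, hb]
    simp only [AffineMap.lineMap_apply, Function.comp, vsub_eq_sub, vadd_eq_add]
    module
  · have hcc : ContinuousOn (φ ∘ m) (Icc a' b') := hφc.comp hc.continuousOn hmaps
    have hmm : MonotoneOn (φ ∘ m) (Icc a' b') ∨ AntitoneOn (φ ∘ m) (Icc a' b') :=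
      hφm.imp (fun h => h.comp (hm.monotoneOn _) hmaps)
        (fun h p hp q hq hpq => h (hmaps hp) (hmaps hq) (hm hpq))
    rcases hε with rfl | rfl
    · refine Or.inr ⟨z + w, φ ∘ m, hcc, hmm, by simpa [ha, hb] using hle, fun t ht => ?_⟩
      rw [hγ t ht, h _ (hmaps ht)]
      simp only [Function.comp]
      module
    · refine Or.inr ⟨-z + w, fun t => (φ ∘ m) t + π, hcc.add continuousOn_const,
        hmm.imp (fun h => h.add_const π) (fun h => h.add_const π),
        by simpa [ha, hb] using hle, fun t ht => ?_⟩
      rw [hγ t ht, h _ (hmaps ht)]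
      have : (!₂[cos ((φ ∘ m) t + π), sin ((φ ∘ m) t + π)] : Plane)
          = -!₂[cos (φ (m t)), sin (φ (m t))] := by
        apply plane_ext <;> simp
      rw [this]
      module

lemma Pieces.transform {ε : ℝ} (hε : ε = 1 ∨ ε = -1) {w : Plane} {m : I → I} (hm : Monotone m)
    (hc : Continuous m) {a' b' : I} (hab : a' ≤ b') (ha : m a' = a) (hb : m b' = b)
    (hγ : ∀ t ∈ Icc a' b', γ' t = ε • γ (m t) + w) (h : Pieces s γ n a b) :
    Pieces s γ' n a' b' := by
  induction h generalizing b' with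
  | single _ hp => exact .single hab (hp.transform hε hm hc hab ha hb hγ)
  | @snoc n a b c h hbc hp ih =>
    -- Breakpoints are pulled back through the reparametrization by the intermediate value theorem.
    obtain ⟨t, ht, hmt⟩ := intermediate_value_Icc hab hc.continuousOn
      (show b ∈ Icc (m a') (m b') from ⟨ha ▸ h.le, hb ▸ hbc⟩)
    refine .snoc (ih ht.1 ha hmt fun r hr => hγ r ⟨hr.1, hr.2.trans ht.2⟩) ht.2 ?_
    exact hp.transform hε hm hc ht.2 hmt hb fun r hr => hγ r ⟨ht.1.trans hr.1, hr.2⟩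

lemma Piece.reverse (h : Piece s γ a b) : Piece s (γ ∘ σ) (σ b) (σ a) := by
  have hmaps : MapsTo (σ : I → I) (Icc (σ b) (σ a)) (Icc a b) := fun t ht => by
    have h1 := unitInterval.strictAnti_symm.antitone ht.1
    have h2 := unitInterval.strictAnti_symm.antitone ht.2
    simp only [unitInterval.symm_symm] at h1 h2
    exact ⟨h2, h1⟩
  have hanti : AntitoneOn (σ : I → I) (Icc (σ b) (σ a)) :=
    unitInterval.strictAnti_symm.antitone.antitoneOn _
  rcases h with ⟨φ, hφ, h⟩ | ⟨z, φ, hφc, hφm, hle, h⟩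
  · refine Or.inl ⟨fun t => 1 - φ (σ t), ?_, fun t ht => ?_⟩
    · intro x hx y hy hxy
      have := hφ (hmaps hy) (hmaps hx) (hanti hx hy hxy)
      simp only; linarith
    · simp only [Function.comp, unitInterval.symm_symm, h _ (hmaps ht)]
      rw [AffineMap.lineMap_apply_one_sub]
  · refine Or.inr ⟨z, φ ∘ σ, hφc.comp unitInterval.continuous_symm.continuousOn hmaps, ?_, ?_,
      fun t ht => h _ (hmaps ht)⟩
    · rcases hφm with hφm | hφm
      · exact Or.inr fun p hp q hq hpq => hφm (hmaps hq) (hmaps hp) (hanti hp hq hpq)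
      · exact Or.inl fun p hp q hq hpq => hφm (hmaps hq) (hmaps hp) (hanti hp hq hpq)
    · simpa [abs_sub_comm] using hle

lemma Pieces.reverse (h : Pieces s γ n a b) : Pieces s (γ ∘ σ) n (σ b) (σ a) := by
  induction h with
  | single hab hp => exact .single (unitInterval.strictAnti_symm.antitone hab) hp.reverse
  | snoc _ hbc hp ih =>
    rw [add_comm]
    exact (Pieces.single (unitInterval.strictAnti_symm.antitone hbc) hp.reverse).append ih

end Pieces

/-! ### Comparison of arc lengths. -/

lemma eVariationOn_le_of_edist_le {E F : Type*} [PseudoEMetricSpace E] [PseudoEMetricSpace F]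
    {α : Type*} [LinearOrder α] {f : α → E} {g : α → F} {S : Set α}
    (h : ∀ x ∈ S, ∀ y ∈ S, edist (f x) (f y) ≤ edist (g x) (g y)) :
    eVariationOn f S ≤ eVariationOn g S := by
  refine iSup_mono fun p => Finset.sum_le_sum fun i _ => h _ ?_ _ ?_
  exacts [p.2.2.2 _, p.2.2.2 _]

lemma eVariationOn_transform_le {γ γ' : I → Plane} {ε : ℝ} (hε : ε = 1 ∨ ε = -1) {w : Plane}
    {m : I → I} (hm : Monotone m) {S : Set I} (hγ : ∀ t ∈ S, γ' t = ε • γ (m t) + w) :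
    eVariationOn γ' S ≤ eVariationOn γ univ := by
  refine le_trans (eVariationOn_le_of_edist_le (g := γ ∘ m) fun x hx y hy => ?_)
    (eVariationOn.comp_le_of_monotoneOn γ m (hm.monotoneOn S) (mapsTo_univ _ _))
  rw [hγ x hx, hγ y hy]
  rcases hε with rfl | rfl <;> simp [edist_neg_neg]

lemma eVariationOn_univ_split (f : I → Plane) (c : I) :
    eVariationOn f univ = eVariationOn f (Icc 0 c) + eVariationOn f (Icc c 1) := by
  have := eVariationOn.Icc_add_Icc f (s := univ) (unitInterval.nonneg' (t := c))
    (unitInterval.le_one' (t := c)) (mem_univ _)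
  simp only [univ_inter] at this
  rw [this]
  congr 1
  ext t; simp [unitInterval.le_one']

/-- The affine reparametrization `t ↦ c * t - d`, clamped to the unit interval. -/
def ramp (c d : ℝ) (t : I) : I := projIcc 0 1 zero_le_one (c * t - d)

lemma continuous_ramp (c d : ℝ) : Continuous (ramp c d) := by
  unfold ramp; exact continuous_projIcc.comp (by fun_prop)

lemma monotone_ramp {c : ℝ} (hc : 0 ≤ c) (d : ℝ) : Monotone (ramp c d) := fun x y hxy =>
  monotone_projIcc _ (by
    have : (x : ℝ) ≤ y := hxy
    nlinarith)

lemma ramp_eq_zero {c d : ℝ} {t : I} (h : c * t ≤ d) : ramp c d t = 0 :=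
  projIcc_of_le_left _ (by linarith)

lemma ramp_eq_one {c d : ℝ} {t : I} (h : d + 1 ≤ c * t) : ramp c d t = 1 :=
  projIcc_of_right_le _ (by linarith)

/-! ### Curves of bounded length and complexity that avoid the disc. -/

/-- There is a curve from `X` to `Y` outside the open disc of radius `s` about the origin that has
length at most `ℓ` and consists of at most `n` segments and arcs of radius `s`. -/
def Reach (s : ℝ) (n : ℕ) (X Y : Plane) (ℓ : ℝ) : Prop :=
  ∃ f : I → Plane, Continuous f ∧ f 0 = X ∧ f 1 = Y ∧ (∀ t, s ≤ ‖f t‖) ∧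
    eVariationOn f univ ≤ ENNReal.ofReal ℓ ∧ ∃ k ≤ n, Pieces s f k 0 1

section Reach

variable {s : ℝ} {n k : ℕ} {X Y Z : Plane} {ℓ ℓ' : ℝ}

lemma Reach.mono (h : Reach s n X Y ℓ) (hn : n ≤ k) (hℓ : ℓ ≤ ℓ') : Reach s k X Y ℓ' := by
  obtain ⟨f, h1, h2, h3, h4, h5, j, h6, h7⟩ := h
  exact ⟨f, h1, h2, h3, h4, h5.trans (ENNReal.ofReal_le_ofReal hℓ), j, h6.trans hn, h7⟩

lemma Reach.reverse (h : Reach s n X Y ℓ) : Reach s n Y X ℓ := by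
  obtain ⟨f, h1, h2, h3, h4, h5, j, h6, h7⟩ := h
  refine ⟨f ∘ σ, h1.comp unitInterval.continuous_symm, by simp [h3], by simp [h2],
    fun t => h4 _, ?_, j, h6, by simpa using h7.reverse⟩
  exact (eVariationOn.comp_le_of_antitoneOn f σ
    (unitInterval.strictAnti_symm.antitone.antitoneOn _) (mapsTo_univ _ _)).trans h5

lemma Reach.trans (hℓ : 0 ≤ ℓ) (hℓ' : 0 ≤ ℓ') (h : Reach s n X Y ℓ) (h' : Reach s k Y Z ℓ') :
    Reach s (n + k) X Z (ℓ + ℓ') := by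
  obtain ⟨f, f1, f2, f3, f4, f5, i, f6, f7⟩ := h
  obtain ⟨g, g1, g2, g3, g4, g5, j, g6, g7⟩ := h'
  set half : I := ⟨1 / 2, by norm_num, by norm_num⟩ with hhalf
  -- The clamped ramps let `g` rest at `Y` during the first half and `f` rest at `Y` during the
  -- second, so a single formula concatenates the curves and is visibly continuous.
  set q : I → Plane := fun t => f (ramp 2 0 t) + g (ramp 2 1 t) - Y with hq
  have e1 : ∀ t ∈ Icc (0 : I) half, q t = (1 : ℝ) • f (ramp 2 0 t) + 0 := fun t ht => by
    have ht2 : (t : ℝ) ≤ 1 / 2 := ht.2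
    simp only [hq]
    rw [ramp_eq_zero (c := 2) (d := 1) (by linarith), g2]; simp
  have e2 : ∀ t ∈ Icc half (1 : I), q t = (1 : ℝ) • g (ramp 2 1 t) + 0 := fun t ht => by
    have ht2 : 1 / 2 ≤ (t : ℝ) := ht.1
    simp only [hq]
    rw [ramp_eq_one (c := 2) (d := 0) (by linarith), f3]; simp
  have a0 : ramp 2 0 0 = 0 := ramp_eq_zero (by simp)
  have a1 : ramp 2 0 half = 1 := ramp_eq_one (by simp [hhalf])
  have b0 : ramp 2 1 half = 0 := ramp_eq_zero (by simp [hhalf])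
  have b1 : ramp 2 1 1 = 1 := ramp_eq_one (by norm_num)
  have l0 : (0 : I) ≤ half := unitInterval.nonneg'
  have l1 : half ≤ 1 := unitInterval.le_one'
  refine ⟨q, ?_, ?_, ?_, ?_, ?_, i + j, add_le_add f6 g6, ?_⟩
  · exact ((f1.comp (continuous_ramp _ _)).add (g1.comp (continuous_ramp _ _))).sub
      continuous_const
  · rw [e1 0 ⟨le_rfl, l0⟩, a0, f2]; simp
  · rw [e2 1 ⟨l1, le_rfl⟩, b1, g3]; simp
  · intro t
    rcases le_total t half with ht | ht
    · rw [e1 t ⟨unitInterval.nonneg', ht⟩]; simpa using f4 _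
    · rw [e2 t ⟨ht, unitInterval.le_one'⟩]; simpa using g4 _
  · rw [eVariationOn_univ_split q half, ENNReal.ofReal_add hℓ hℓ']
    exact add_le_add
      ((eVariationOn_transform_le (Or.inl rfl) (monotone_ramp (by norm_num) _) e1).trans f5)
      ((eVariationOn_transform_le (Or.inl rfl) (monotone_ramp (by norm_num) _) e2).trans g5)
  · exact (f7.transform (Or.inl rfl) (monotone_ramp (by norm_num) _) (continuous_ramp _ _)
      l0 a0 a1 e1).append (g7.transform (Or.inl rfl) (monotone_ramp (by norm_num) _)
      (continuous_ramp _ _) l1 b0 b1 e2)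

lemma eVariationOn_lipschitz_le {f : I → Plane} {C : ℝ} (hC : 0 ≤ C)
    (h : ∀ x y : I, dist (f x) (f y) ≤ C * dist x y) :
    eVariationOn f univ ≤ ENNReal.ofReal C := by
  have h1 : eVariationOn f univ ≤ eVariationOn (fun t : I => C * (t : ℝ)) univ := by
    apply eVariationOn_le_of_edist_le
    intro x _ y _
    rw [edist_dist, edist_dist]
    apply ENNReal.ofReal_le_ofReal
    refine (h x y).trans (le_of_eq ?_)
    rw [Real.dist_eq, ← mul_sub, abs_mul, abs_of_nonneg hC]; rfl
  refine h1.trans ?_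
  have hm : MonotoneOn (fun t : I => C * (t : ℝ)) univ := fun x _ y _ hxy =>
    mul_le_mul_of_nonneg_left hxy hC
  have := hm.eVariationOn_eq (mem_univ 0) (mem_univ 1)
  rw [show (univ : Set I) = univ ∩ Icc 0 1 by
    ext t; simp [unitInterval.le_one'], this]
  simp

lemma Reach.segment (h : ∀ r ∈ Icc (0 : ℝ) 1, s ≤ ‖AffineMap.lineMap X Y r‖) :
    Reach s 1 X Y ‖Y - X‖ := by
  refine ⟨fun t => AffineMap.lineMap X Y (t : ℝ), ?_, by simp, by simp, fun t => h _ t.2, ?_, 1,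
    le_rfl, .single zero_le_one (Or.inl ⟨fun t => t, fun _ _ _ _ h => h, fun t _ => by simp⟩)⟩
  · exact AffineMap.lineMap_continuous.comp continuous_subtype_val
  · apply eVariationOn_lipschitz_le (norm_nonneg _)
    intro x y
    rw [dist_lineMap_lineMap, mul_comm, dist_comm X Y, dist_eq_norm Y X]; rfl

lemma Reach.refl (h : s ≤ ‖X‖) : Reach s 1 X X 0 := by
  have := Reach.segment (s := s) (X := X) (Y := X) (fun r _ => by simpa using h)
  simpa using this

lemma Reach.segment_of_hdot {θ : ℝ} (hX : s ≤ hdot X θ) (hY : s ≤ hdot Y θ) :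
    Reach s 1 X Y ‖Y - X‖ := by
  apply Reach.segment
  intro r hr
  refine le_trans ?_ (hdot_le _ θ)
  rw [AffineMap.lineMap_apply, vsub_eq_sub, vadd_eq_add, hdot_add, hdot_smul, hdot_sub]
  nlinarith [hr.1, hr.2]

/-- A segment that starts outside the disc and leads away from the origin avoids the disc. -/
lemma Reach.segment_of_inner {θ r : ℝ} (hr : 0 ≤ r) (hX : s ≤ ‖X‖)
    (hθ : 0 ≤ hdot X θ) (hY : Y = X + r • uvec θ) : Reach s 1 X Y ‖Y - X‖ := by
  subst hY
  apply Reach.segment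
  intro q hq
  refine hX.trans ?_
  rw [AffineMap.lineMap_apply, vsub_eq_sub, vadd_eq_add, add_sub_cancel_left]
  rw [← sq_le_sq₀ (norm_nonneg _) (norm_nonneg _), norm_sq_eq_dots _ θ, norm_sq_eq_dots _ θ]
  simp
  have : 0 ≤ q * r := mul_nonneg hq.1 hr
  nlinarith [mul_nonneg this hθ, mul_nonneg this this]

lemma Reach.tangent (s θ r r' : ℝ) :
    Reach s 1 (s • uvec θ + r • tvec θ) (s • uvec θ + r' • tvec θ) |r' - r| := by
  have := Reach.segment_of_hdot (s := s) (X := s • uvec θ + r • tvec θ)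
    (Y := s • uvec θ + r' • tvec θ) (θ := θ) (by simp) (by simp)
  convert this using 1
  rw [show s • uvec θ + r' • tvec θ - (s • uvec θ + r • tvec θ) = (r' - r) • tvec θ by module,
    norm_smul, norm_tvec, mul_one, Real.norm_eq_abs]

lemma dist_uvec_le (x y : ℝ) : dist (uvec x) (uvec y) ≤ |x - y| := by
  rw [dist_eq_norm]
  refine abs_le_of_sq_le_sq' (a := ‖uvec x - uvec y‖) ?_ (abs_nonneg _) |>.2
  rw [sq_abs, norm_sq_eq_dots _ x]
  simp only [hdot_sub, vdot_sub, hdot_uvec_self, vdot_uvec_self, hdot_uvec, vdot_uvec]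
  have h1 := one_sub_sq_div_two_le_cos (x := x - y)
  nlinarith [sin_sq_add_cos_sq (x - y)]

lemma Reach.arc (hs : 0 ≤ s) {x y : ℝ} (hxy : x ≤ y) (hy : y ≤ x + 2 * π) :
    Reach s 1 (s • uvec x) (s • uvec y) (s * (y - x)) := by
  refine ⟨fun t => s • uvec (x + (y - x) * (t : ℝ)), ?_, by simp, by simp, fun t => ?_, ?_, 1,
    le_rfl, .single zero_le_one (Or.inr ⟨0, fun t => x + (y - x) * (t : ℝ), by fun_prop,
      Or.inl fun p _ q _ h => ?_, ?_, fun t _ => by simp [uvec]⟩)⟩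
  · exact (continuous_uvec.comp (by fun_prop)).const_smul s
  · simp [norm_smul, abs_of_nonneg hs]
  · apply eVariationOn_lipschitz_le (mul_nonneg hs (by linarith))
    intro p q
    rw [dist_smul₀, Real.norm_eq_abs, abs_of_nonneg hs, mul_assoc]
    refine mul_le_mul_of_nonneg_left ((dist_uvec_le _ _).trans (le_of_eq ?_)) hs
    rw [add_sub_add_left_eq_sub, ← mul_sub, abs_mul, abs_of_nonneg (by linarith : 0 ≤ y - x)]; rfl
  · have : (p : ℝ) ≤ q := h
    simp only
    nlinarith
  · simp; rw [abs_of_nonneg (by linarith)]; linarith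

end Reach

/-! ### Curves composed of a tangent, an arc and a tangent. -/

/-- The curve that follows the tangent at polar angle `x` of the circle of radius `s`, the arc from
`x` to `y`, and the tangent at `y`; the parameter is the arc length measured from the first point
of tangency. -/
def stadium (s x y r : ℝ) : Plane :=
  s • uvec (x + max 0 (min (r / s) (y - x))) + min r 0 • tvec x
    + max (r - s * (y - x)) 0 • tvec y

section Stadium

variable {s x y r : ℝ}

lemma continuous_stadium : Continuous (stadium s x y) := by
  unfold stadium
  refine ((Continuous.const_smul (continuous_uvec.comp (by fun_prop)) s).add ?_).add ?_
  · exact (by fun_prop : Continuous fun r : ℝ => min r 0).smul continuous_const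
  · exact (by fun_prop : Continuous fun r : ℝ => max (r - s * (y - x)) 0).smul continuous_const

lemma stadium_of_nonpos (hs : 0 < s) (hxy : x ≤ y) (hr : r ≤ 0) :
    stadium s x y r = s • uvec x + r • tvec x := by
  have h1 : r / s ≤ 0 := div_nonpos_of_nonpos_of_nonneg hr hs.le
  have h2 : 0 ≤ s * (y - x) := mul_nonneg hs.le (by linarith)
  rw [stadium, max_eq_left ((min_le_left _ _).trans h1), min_eq_left hr, max_eq_right (by linarith)]
  simp

lemma stadium_of_mem (hs : 0 < s) (hr : 0 ≤ r) (hr' : r ≤ s * (y - x)) :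
    stadium s x y r = s • uvec (x + r / s) := by
  have h1 : 0 ≤ r / s := div_nonneg hr hs.le
  have h2 : r / s ≤ y - x := by rw [div_le_iff₀ hs]; linarith
  rw [stadium, min_eq_left h2, max_eq_right h1, min_eq_right hr, max_eq_right (by linarith)]
  simp

lemma stadium_of_ge (hs : 0 < s) (hxy : x ≤ y) (hr : s * (y - x) ≤ r) :
    stadium s x y r = s • uvec y + (r - s * (y - x)) • tvec y := by
  have h0 : 0 ≤ s * (y - x) := mul_nonneg hs.le (by linarith)
  have h2 : y - x ≤ r / s := by rw [le_div_iff₀ hs]; linarith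
  rw [stadium, min_eq_right h2, max_eq_right (by linarith), min_eq_right (by linarith),
    max_eq_left (by linarith)]
  simp

lemma stadium_arc (hs : 0 < s) {θ : ℝ} (h1 : x ≤ θ) (h2 : θ ≤ y) :
    stadium s x y (s * (θ - x)) = s • uvec θ := by
  rw [stadium_of_mem hs (mul_nonneg hs.le (by linarith)) (by gcongr)]
  congr 2; field_simp; ring

/-- Subcurves of a stadium curve. -/
lemma Reach.stadium (hs : 0 < s) (hxy : x ≤ y) (hy : y ≤ x + 2 * π) {r r' : ℝ} (hr : r ≤ r') :
    Reach s 3 (stadium s x y r) (stadium s x y r') (r' - r) := by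
  set d := s * (y - x) with hd
  have hd0 : 0 ≤ d := mul_nonneg hs.le (by linarith)
  have A : ∀ p q : ℝ, p ≤ q → q ≤ 0 →
      Reach s 1 (TwoDiscs.stadium s x y p) (TwoDiscs.stadium s x y q) (q - p) := by
    intro p q h1 h2
    rw [stadium_of_nonpos hs hxy (h1.trans h2), stadium_of_nonpos hs hxy h2]
    have := Reach.tangent s x p q
    rwa [abs_of_nonneg (by linarith)] at this
  have B : ∀ p q : ℝ, 0 ≤ p → p ≤ q → q ≤ d →
      Reach s 1 (TwoDiscs.stadium s x y p) (TwoDiscs.stadium s x y q) (q - p) := by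
    intro p q h0 h1 h2
    rw [stadium_of_mem hs h0 (h1.trans h2), stadium_of_mem hs (h0.trans h1) h2]
    have hp : 0 ≤ p / s := div_nonneg h0 hs.le
    have hq : q / s ≤ y - x := by rw [div_le_iff₀ hs]; linarith
    have hpq : p / s ≤ q / s := by gcongr
    have := Reach.arc hs.le (x := x + p / s) (y := x + q / s) (by linarith) (by linarith)
    convert this using 1
    field_simp; ring
  have C : ∀ p q : ℝ, d ≤ p → p ≤ q →
      Reach s 1 (TwoDiscs.stadium s x y p) (TwoDiscs.stadium s x y q) (q - p) := by
    intro p q h1 h2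
    rw [stadium_of_ge hs hxy h1, stadium_of_ge hs hxy (h1.trans h2)]
    have := Reach.tangent s y (p - d) (q - d)
    rwa [abs_of_nonneg (by linarith), sub_sub_sub_cancel_right] at this
  rcases le_total r' 0 with h | h
  · exact (A r r' hr h).mono (by norm_num) le_rfl
  have D : ∀ p : ℝ, 0 ≤ p → p ≤ r' →
      Reach s 2 (TwoDiscs.stadium s x y p) (TwoDiscs.stadium s x y r') (r' - p) := by
    intro p h0 h1
    rcases le_total r' d with h2 | h2
    · exact (B p r' h0 h1 h2).mono (by norm_num) le_rfl
    rcases le_total p d with h3 | h3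
    · have := (B p d h0 h3 le_rfl).trans (by linarith) (by linarith) (C d r' le_rfl h2)
      exact this.mono le_rfl (by linarith)
    · exact (C p r' h3 h1).mono (by norm_num) le_rfl
  rcases le_total r 0 with h3 | h3
  · have := (A r 0 h3 le_rfl).trans (by linarith) (by linarith) (D 0 le_rfl h)
    exact this.mono le_rfl (by linarith)
  · exact (D r h3 hr).mono (by norm_num) le_rfl

end Stadium

/-! ### Tangency conditions and geodesics around the disc. -/

section Tangents

variable {s x y : ℝ} {X Y : Plane}

/-- One-sided first-order condition: the tangential component is the derivative of the height with
respect to the angle. -/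
lemma vdot_nonpos_of_le_right (hxy : x < y) (h : ∀ t ∈ Ioo x y, hdot X t ≤ hdot X x) :
    vdot X x ≤ 0 := by
  have h1 := (hasDerivAt_hdot X x).hasDerivWithinAt (s := Ioi x)
  rw [hasDerivWithinAt_iff_tendsto_slope' (by simp)] at h1
  refine le_of_tendsto h1 ?_
  filter_upwards [Ioo_mem_nhdsGT hxy] with t ht
  rw [slope_def_field]
  exact div_nonpos_of_nonpos_of_nonneg (by linarith [h t ht]) (by linarith [ht.1])

lemma vdot_nonneg_of_le_left (hxy : x < y) (h : ∀ t ∈ Ioo x y, hdot X t ≤ hdot X y) :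
    0 ≤ vdot X y := by
  have h1 := (hasDerivAt_hdot X y).hasDerivWithinAt (s := Iio y)
  rw [hasDerivWithinAt_iff_tendsto_slope' (by simp)] at h1
  refine ge_of_tendsto h1 ?_
  filter_upwards [Ioo_mem_nhdsLT hxy] with t ht
  rw [slope_def_field]
  exact div_nonneg_of_nonpos (by linarith [h t ht]) (by linarith [ht.2])

lemma stadium_eq_left (hs : 0 < s) (hxy : x ≤ y) (hX : hdot X x = s) (hX' : vdot X x ≤ 0) :
    stadium s x y (vdot X x) = X := by
  rw [stadium_of_nonpos hs hxy hX', ← hX, ← eq_dots]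

lemma stadium_eq_right (hs : 0 < s) (hxy : x ≤ y) (hY : hdot Y y = s) (hY' : 0 ≤ vdot Y y) :
    stadium s x y (s * (y - x) + vdot Y y) = Y := by
  rw [stadium_of_ge hs hxy (by linarith), add_sub_cancel_left]
  nth_rw 1 [← hY]
  rw [← eq_dots]

/-- The curve stays within every half-plane that touches the disc at an angle in `[x, y]`, as the
tangents at `x` and `y` lead away from those directions. -/
lemma hdot_stadium_le (hs : 0 < s) (hxy : x ≤ y) (hy : y ≤ x + π) (r : ℝ) {θ : ℝ}
    (hθ : θ ∈ Icc x y) : hdot (stadium s x y r) θ ≤ s := by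
  have hc : ∀ z, s * cos z ≤ s := fun z => by nlinarith [cos_le_one z]
  rcases le_total r 0 with h | h
  · rw [stadium_of_nonpos hs hxy h, hdot_add, hdot_smul, hdot_smul, hdot_uvec, hdot_tvec]
    have := sin_nonneg_of_nonneg_of_le_pi (x := θ - x) (by linarith [hθ.1]) (by linarith [hθ.2])
    nlinarith [hc (θ - x)]
  rcases le_total r (s * (y - x)) with h' | h'
  · rw [stadium_of_mem hs h h', hdot_smul, hdot_uvec]; exact hc _
  · rw [stadium_of_ge hs hxy h', hdot_add, hdot_smul, hdot_smul, hdot_uvec, hdot_tvec]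
    have := sin_nonpos_of_nonpos_of_neg_pi_le (x := θ - y) (by linarith [hθ.2])
      (by linarith [hθ.1])
    nlinarith [hc (θ - y)]

lemma reach_tangent (hs : 0 < s) (hxy : x ≤ y) (hy : y ≤ x + π) (hX : hdot X x = s)
    (hX' : vdot X x ≤ 0) (hY : hdot Y y = s) (hY' : 0 ≤ vdot Y y) :
    Reach s 3 X Y (-vdot X x + s * (y - x) + vdot Y y) := by
  have h0 : 0 ≤ s * (y - x) := mul_nonneg hs.le (by linarith)
  have := Reach.stadium hs hxy (by linarith [pi_pos]) (r := vdot X x)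
    (r' := s * (y - x) + vdot Y y) (by linarith)
  rw [stadium_eq_left hs hxy hX hX', stadium_eq_right hs hxy hY hY'] at this
  exact this.mono le_rfl (by linarith)

/-- Two points on either side of a disc are connected around it at the cost given by the part of
the disc that protrudes beyond the segment. -/
lemma reach_geodesic (hs : 0 < s) (hxy : x ≤ y) (hy : y ≤ x + π) (hX : s ≤ hdot X x)
    (hY : s ≤ hdot Y y) : ∃ ℓ, 0 ≤ ℓ ∧ Reach s 3 X Y ℓ ∧
      ℓ ≤ ‖Y - X‖ + ∫ θ in x..y, max (s - max (hdot X θ) (hdot Y θ)) 0 := by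
  have hcont : Continuous fun θ => s - max (hdot X θ) (hdot Y θ) :=
    continuous_const.sub ((continuous_hdot X).max (continuous_hdot Y))
  have hcont' : Continuous fun θ => max (s - max (hdot X θ) (hdot Y θ)) 0 :=
    hcont.max continuous_const
  by_cases hcom : ∃ θ ∈ Icc x y, s ≤ hdot X θ ∧ s ≤ hdot Y θ
  · obtain ⟨θ, hθ, h1, h2⟩ := hcom
    refine ⟨‖Y - X‖, norm_nonneg _, (Reach.segment_of_hdot h1 h2).mono (by norm_num) le_rfl, ?_⟩
    have : 0 ≤ ∫ θ in x..y, max (s - max (hdot X θ) (hdot Y θ)) 0 :=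
      intervalIntegral.integral_nonneg hxy fun θ _ => le_max_right _ _
    linarith
  push Not at hcom
  -- Points of tangency: `p` is the last angle at which `X` has height `s`, and `q` the first one
  -- after `p` at which `Y` has.
  have hSc : IsCompact (Icc x y ∩ hdot X ⁻¹' Ici s) :=
    isCompact_Icc.inter_right (isClosed_Ici.preimage (continuous_hdot X))
  obtain ⟨p, ⟨hp, hpX⟩, hpmax⟩ := hSc.exists_isGreatest ⟨x, ⟨le_rfl, hxy⟩, hX⟩
  have hTc : IsCompact (Icc p y ∩ hdot Y ⁻¹' Ici s) :=
    isCompact_Icc.inter_right (isClosed_Ici.preimage (continuous_hdot Y))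
  obtain ⟨q, ⟨hq, hqY⟩, hqmin⟩ := hTc.exists_isLeast ⟨y, ⟨hp.2, le_rfl⟩, hY⟩
  simp only [mem_preimage, mem_Ici] at hpX hqY
  have hlt : ∀ t ∈ Ioc p y, hdot X t < s := fun t ht => by
    by_contra! h
    exact absurd (hpmax ⟨⟨hp.1.trans ht.1.le, ht.2⟩, h⟩) (not_le.2 ht.1)
  have hlt' : ∀ t ∈ Ico p q, hdot Y t < s := fun t ht => by
    by_contra! h
    exact absurd (hqmin ⟨⟨ht.1, ht.2.le.trans hq.2⟩, h⟩) (not_le.2 ht.2)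
  have hpY : hdot Y p < s := hcom p hp hpX
  have hpq : p < q := lt_of_le_of_ne hq.1 fun h => by rw [h] at hpY; linarith
  have hpX' : hdot X p = s := by
    refine le_antisymm ?_ hpX
    by_contra! h
    obtain ⟨t, ht, ht'⟩ := intermediate_value_Icc' hq.1 (continuous_hdot X).continuousOn
      (show s ∈ Icc (hdot X q) (hdot X p) from ⟨(hlt q ⟨hpq, hq.2⟩).le, hpX⟩)
    rcases ht.1.eq_or_lt with rfl | h1
    · linarith
    · linarith [hlt t ⟨h1, ht.2.trans hq.2⟩]
  have hqY' : hdot Y q = s := by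
    refine le_antisymm ?_ hqY
    by_contra! h
    obtain ⟨t, ht, ht'⟩ := intermediate_value_Icc hq.1 (continuous_hdot Y).continuousOn
      (show s ∈ Icc (hdot Y p) (hdot Y q) from ⟨hpY.le, hqY⟩)
    rcases ht.2.eq_or_lt with rfl | h1
    · linarith
    · linarith [hlt' t ⟨ht.1, h1⟩]
  have hvX : vdot X p ≤ 0 := vdot_nonpos_of_le_right hpq fun t ht => by
    rw [hpX']; exact (hlt t ⟨ht.1, ht.2.le.trans hq.2⟩).le
  have hvY : 0 ≤ vdot Y q := vdot_nonneg_of_le_left hpq fun t ht => by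
    rw [hqY']; exact (hlt' t ⟨ht.1.le, ht.2⟩).le
  have h0 : 0 ≤ s * (q - p) := mul_nonneg hs.le (by linarith)
  refine ⟨_, by linarith, reach_tangent hs hpq.le (by linarith [hp.1, hq.2]) hpX' hvX hqY' hvY, ?_⟩
  have hi : ∀ c d, IntervalIntegrable (fun θ => max (s - max (hdot X θ) (hdot Y θ)) 0)
    MeasureTheory.volume c d := fun c d => hcont'.intervalIntegrable _ _
  have e1 : ∫ θ in p..q, (s - max (hdot X θ) (hdot Y θ)) ≤
      ∫ θ in x..y, max (s - max (hdot X θ) (hdot Y θ)) 0 := by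
    refine (intervalIntegral.integral_mono_on hpq.le (hcont.intervalIntegrable _ _) (hi _ _)
      fun θ _ => le_max_left _ _).trans ?_
    exact intervalIntegral.integral_mono_interval hp.1 hpq.le hq.2
      (Filter.Eventually.of_forall fun θ => le_max_right _ _) (hi _ _)
  have hsX : IntervalIntegrable (fun θ => s - hdot X θ) MeasureTheory.volume p q :=
    (continuous_const.sub (continuous_hdot X)).intervalIntegrable _ _
  have e2 : ∫ θ in p..q, (s - max (hdot X θ) (hdot Y θ)) =
      s * (q - p) - (vdot X p - vdot X q) - ∫ θ in p..q, max (hdot (Y - X) θ) 0 := by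
    rw [← integral_hdot, show s * (q - p) = ∫ _ in p..q, s by simp; ring,
      ← intervalIntegral.integral_sub (by simp) ((continuous_hdot X).intervalIntegrable _ _),
      ← intervalIntegral.integral_sub hsX
        (((continuous_hdot _).max continuous_const).intervalIntegrable _ _)]
    congr 1; ext θ
    rw [hdot_sub, sub_sub, ← max_add_add_left]; simp [max_comm]
  -- Over `[p, q]` the maximum of the two heights is that of `X` plus the positive part for `Y - X`.
  -- Integrating that part turns the tangent and arc lengths into ‖Y - X‖ plus the protrusion.
  have e3 := integral_posPart_hdot_le (Z := Y - X) hpq.le (by linarith [hp.1, hq.2])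
    (by simp; linarith) (by simp; linarith [hlt q ⟨hpq, hq.2⟩])
  rw [vdot_sub] at e3
  linarith

end Tangents

/-! ### The parallelogram, the excess of the disc, and three-phase schedules. -/

/-- The support function of the parallelogram with vertices `P`, `P + a`, `P + b`, `P + a + b`. -/
def supp (P a b : Plane) (θ : ℝ) : ℝ := hdot P θ + max (hdot a θ) 0 + max (hdot b θ) 0

/-- The amount by which the disc of radius `s` protrudes beyond the parallelogram in the
direction `uvec θ`. -/
def excess (s : ℝ) (P a b : Plane) (θ : ℝ) : ℝ := max (s - supp P a b θ) 0

lemma continuous_supp (P a b : Plane) : Continuous (supp P a b) :=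
  ((continuous_hdot P).add ((continuous_hdot a).max continuous_const)).add
    ((continuous_hdot b).max continuous_const)

lemma continuous_excess (s : ℝ) (P a b : Plane) : Continuous (excess s P a b) :=
  (continuous_const.sub (continuous_supp P a b)).max continuous_const

lemma excess_nonneg (s : ℝ) (P a b : Plane) (θ : ℝ) : 0 ≤ excess s P a b θ := le_max_right _ _

lemma supp_comm (P a b : Plane) : supp P a b = supp P b a := by
  ext θ; simp only [supp]; ring

lemma excess_comm (s : ℝ) (P a b : Plane) : excess s P a b = excess s P b a := by
  ext θ; rw [excess, supp_comm]; rfl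

/-- A decoupled motion of the difference vector `P` to `P + a + b`: one disc moves in the middle
phase, the other one in the two outer phases. -/
def Schedule (s : ℝ) (P a b : Plane) (ℓ : ℝ) : Prop :=
  ∃ X₁ X₂ ℓ₁ ℓ₂ ℓ₃, 0 ≤ ℓ₁ ∧ 0 ≤ ℓ₂ ∧ 0 ≤ ℓ₃ ∧ Reach s 3 P X₁ ℓ₁ ∧ Reach s 3 X₁ X₂ ℓ₂ ∧
    Reach s 3 X₂ (P + a + b) ℓ₃ ∧ (X₂ - X₁ = a ∨ X₂ - X₁ = b) ∧ ℓ₁ + ℓ₂ + ℓ₃ ≤ ℓ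

section Schedule

variable {s ℓ ℓ' x y t θ : ℝ} {P a b : Plane}

lemma Schedule.mono (h : Schedule s P a b ℓ) (hℓ : ℓ ≤ ℓ') : Schedule s P a b ℓ' := by
  obtain ⟨X₁, X₂, ℓ₁, ℓ₂, ℓ₃, h1, h2, h3, h4, h5, h6, h7, h8⟩ := h
  exact ⟨X₁, X₂, ℓ₁, ℓ₂, ℓ₃, h1, h2, h3, h4, h5, h6, h7, h8.trans hℓ⟩

lemma Schedule.swap (h : Schedule s P a b ℓ) : Schedule s P b a ℓ := by
  obtain ⟨X₁, X₂, ℓ₁, ℓ₂, ℓ₃, h1, h2, h3, h4, h5, h6, h7, h8⟩ := h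
  exact ⟨X₁, X₂, ℓ₁, ℓ₂, ℓ₃, h1, h2, h3, h4, h5, by rwa [add_right_comm], h7.symm, h8⟩

lemma Schedule.reverse (h : Schedule s (P + a + b) (-a) (-b) ℓ) : Schedule s P a b ℓ := by
  obtain ⟨X₁, X₂, ℓ₁, ℓ₂, ℓ₃, h1, h2, h3, h4, h5, h6, h7, h8⟩ := h
  refine ⟨X₂, X₁, ℓ₃, ℓ₂, ℓ₁, h3, h2, h1, ?_, h5.reverse, h4.reverse, ?_, by linarith⟩
  · rw [show P + a + b + -a + -b = P by abel] at h6
    exact h6.reverse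
  · refine h7.imp (fun h => ?_) (fun h => ?_) <;>
    · rw [← neg_sub, h, neg_neg]

/-- First one disc moves, then the other one. -/
lemma Schedule.of_corner {ℓ₁ ℓ₂ : ℝ} (hP : s ≤ ‖P‖) (h1 : 0 ≤ ℓ₁) (h2 : 0 ≤ ℓ₂)
    (h : Reach s 3 P (P + a) ℓ₁) (h' : Reach s 3 (P + a) (P + a + b) ℓ₂) :
    Schedule s P a b (ℓ₁ + ℓ₂) :=
  ⟨P, P + a, 0, ℓ₁, ℓ₂, le_rfl, h1, h2, (Reach.refl hP).mono (by norm_num) le_rfl, h, h',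
    Or.inl (by abel), by linarith⟩

lemma Schedule.straight (hP : s ≤ hdot P θ) (hV : s ≤ hdot (P + a) θ)
    (hQ : s ≤ hdot (P + a + b) θ) : Schedule s P a b (‖a‖ + ‖b‖) := by
  have h1 := (Reach.segment_of_hdot hP hV).mono (k := 3) (by norm_num) le_rfl
  have h2 := (Reach.segment_of_hdot hV hQ).mono (k := 3) (by norm_num) le_rfl
  rw [add_sub_cancel_left] at h1 h2
  exact .of_corner (hP.trans (hdot_le _ _)) (norm_nonneg _) (norm_nonneg _) h1 h2

/-- Up to `t` the support of the parallelogram is that of its side from `P` to `P + a`, after `t`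
that of its side from `P + a` to `P + a + b`. Thus the protrusions paid by the two geodesics add up
exactly to the excess integral. -/
lemma Schedule.geodesic_corner (hs : 0 < s) (hxt : x ≤ t) (hty : t ≤ y) (hy : y ≤ x + π)
    (hP : s ≤ hdot P x) (hV : s ≤ hdot (P + a) t) (hQ : s ≤ hdot (P + a + b) y)
    (hb : ∀ θ ∈ Icc x t, hdot b θ ≤ 0) (ha : ∀ θ ∈ Icc t y, 0 ≤ hdot a θ) :
    Schedule s P a b (‖a‖ + ‖b‖ + ∫ θ in x..y, excess s P a b θ) := by
  obtain ⟨ℓ₁, h1, h2, h3⟩ := reach_geodesic hs hxt (by linarith) hP hV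
  obtain ⟨ℓ₂, h4, h5, h6⟩ := reach_geodesic hs hty (by linarith) hV hQ
  refine (Schedule.of_corner (hP.trans (hdot_le _ _)) h1 h4 h2 h5).mono ?_
  rw [add_sub_cancel_left] at h3 h6
  have hi : ∀ c d, IntervalIntegrable (excess s P a b) MeasureTheory.volume c d :=
    fun c d => (continuous_excess s P a b).intervalIntegrable _ _
  rw [← intervalIntegral.integral_add_adjacent_intervals (hi x t) (hi t y)]
  have e1 : ∫ θ in x..t, excess s P a b θ =
      ∫ θ in x..t, max (s - max (hdot P θ) (hdot (P + a) θ)) 0 := by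
    refine intervalIntegral.integral_congr fun θ hθ => ?_
    rw [uIcc_of_le hxt] at hθ
    simp only [excess, supp, hdot_add]
    rw [max_eq_right (hb θ hθ), ← max_add_add_left]
    simp [max_comm]
  have e2 : ∫ θ in t..y, excess s P a b θ =
      ∫ θ in t..y, max (s - max (hdot (P + a) θ) (hdot (P + a + b) θ)) 0 := by
    refine intervalIntegral.integral_congr fun θ hθ => ?_
    rw [uIcc_of_le hty] at hθ
    simp only [excess, supp, hdot_add]
    rw [max_eq_left (ha θ hθ), ← max_add_add_left]
    simp [max_comm]
  rw [e1, e2]; linarith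

end Schedule

/-! ### Dividing one geodesic between the two discs. -/

section Split

variable {s x y : ℝ} {P a b : Plane}

/-- Integrate `s - supp ≤ excess` and estimate the integrals of the positive parts for `a` and `b`
by `integral_posPart_hdot_le`; the tangential components telescope. For tangent end points the left
side is the length of the geodesic. -/
lemma stadium_length_le (hxy : x ≤ y) (hy : y ≤ x + π)
    (hax : hdot a x ≤ 0) (hbx : hdot b x ≤ 0) (hay : 0 ≤ hdot a y) (hby : 0 ≤ hdot b y) :
    -vdot P x + s * (y - x) + vdot (P + a + b) y ≤
      ‖a‖ + ‖b‖ + ∫ θ in x..y, excess s P a b θ := by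
  have h1 := integral_posPart_hdot_le hxy hy hax hay
  have h2 := integral_posPart_hdot_le hxy hy hbx hby
  have hia : IntervalIntegrable (fun θ => max (hdot a θ) 0) MeasureTheory.volume x y :=
    ((continuous_hdot a).max continuous_const).intervalIntegrable _ _
  have hib : IntervalIntegrable (fun θ => max (hdot b θ) 0) MeasureTheory.volume x y :=
    ((continuous_hdot b).max continuous_const).intervalIntegrable _ _
  have hiP : IntervalIntegrable (hdot P) MeasureTheory.volume x y :=
    (continuous_hdot P).intervalIntegrable _ _
  have e1 : ∫ θ in x..y, supp P a b θ = (vdot P x - vdot P y) +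
      (∫ θ in x..y, max (hdot a θ) 0) + ∫ θ in x..y, max (hdot b θ) 0 := by
    rw [← integral_hdot, ← intervalIntegral.integral_add hiP hia,
      ← intervalIntegral.integral_add (hiP.add hia) hib]
    rfl
  have e2 : s * (y - x) - ∫ θ in x..y, supp P a b θ ≤ ∫ θ in x..y, excess s P a b θ := by
    have hsu := (continuous_supp P a b).intervalIntegrable (μ := MeasureTheory.volume) x y
    rw [show s * (y - x) = ∫ _ in x..y, s by simp; ring,
      ← intervalIntegral.integral_sub (by simp) hsu]
    exact intervalIntegral.integral_mono_on hxy ((by simp : IntervalIntegrable (fun _ : ℝ => s)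
      MeasureTheory.volume x y).sub hsu) ((continuous_excess s P a b).intervalIntegrable _ _)
      fun θ _ => le_max_left _ _
  simp only [vdot_add]
  linarith

/-- Beyond the point of direction `n` the curve only descends as seen from `n`, so it is still at
least as high there as its end point. -/
lemma hdot_le_hdot_stadium (hs : 0 < s) (hxy : x ≤ y) (hy : y ≤ x + π) {Q : Plane}
    (hQ : hdot Q y = s) {n r : ℝ} (hn : n ∈ Icc x y) (h1 : s * (n - x) ≤ r)
    (h2 : r ≤ s * (y - x) + vdot Q y) (hQ' : 0 ≤ vdot Q y) :
    hdot Q n ≤ hdot (stadium s x y r) n := by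
  have hsin : sin (n - y) ≤ 0 :=
    sin_nonpos_of_nonpos_of_neg_pi_le (by linarith [hn.2]) (by linarith [hn.1])
  rw [hdot_rotate Q y n, hQ]
  rcases le_total r (s * (y - x)) with h | h
  · have h0 : 0 ≤ s * (n - x) := mul_nonneg hs.le (by linarith [hn.1])
    rw [stadium_of_mem hs (h0.trans h1) h, hdot_smul, hdot_uvec]
    have a1 : n - x ≤ r / s := by rw [le_div_iff₀ hs]; linarith
    have a2 : r / s ≤ y - x := by rw [div_le_iff₀ hs]; linarith
    have : cos (y - n) ≤ cos (x + r / s - n) :=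
      cos_le_cos_of_nonneg_of_le_pi (by linarith) (by linarith [hn.1]) (by linarith)
    rw [← cos_neg, neg_sub, ← cos_neg (n - (x + r / s)), neg_sub]
    nlinarith
  · rw [stadium_of_ge hs hxy h, hdot_add, hdot_smul, hdot_smul, hdot_uvec, hdot_tvec]
    nlinarith

/-- Two points of the stadium curve from `P` to `P + a + b` that differ by `b`. -/
lemma exists_stadium_chord (hs : 0 < s) (hxy : x < y) (hy : y ≤ x + π) (hP : hdot P x = s)
    (hQ : hdot (P + a + b) y = s) (hP' : vdot P x ≤ 0) (hQ' : 0 ≤ vdot (P + a + b) y)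
    (hQx : hdot (P + a + b) x < s) (hV : ∀ θ ∈ Icc x y, hdot (P + a) θ ≤ s) {n : ℝ}
    (hn : n ∈ Icc x y) (hb : b = ‖b‖ • tvec n) (hb0 : b ≠ 0) (han : 0 ≤ hdot a n) :
    ∃ r₁ r₂, vdot P x ≤ r₁ ∧ r₁ ≤ r₂ ∧ r₂ ≤ s * (y - x) + vdot (P + a + b) y ∧
      stadium s x y r₂ - stadium s x y r₁ = b := by
  set Q := P + a + b with hQdef
  set B := ‖b‖ with hB
  have hBpos : 0 < B := norm_pos_iff.2 hb0
  have hbn : hdot b n = 0 := by rw [hb]; simp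
  have hV' : P + a = Q - b := by rw [hQdef]; abel
  have hpq : hdot P n ≤ hdot Q n := by rw [hQdef]; simp; linarith
  have hd0 : 0 ≤ s * (y - x) := mul_nonneg hs.le (by linarith)
  rw [hV'] at hV
  -- If `b` is parallel to the final tangent, the chord is cut off at the very end of the curve.
  rcases hn.2.eq_or_lt with rfl | hny
  · have hv : vdot b n = B := by rw [hb]; simp
    have hvV : 0 ≤ vdot (Q - b) n := vdot_nonneg_of_le_left hxy fun t ht => by
      rw [hdot_sub Q b n, hbn, hQ, sub_zero]; exact hV t ⟨ht.1.le, ht.2.le⟩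
    rw [vdot_sub, hv] at hvV
    refine ⟨s * (n - x) + vdot Q n - B, s * (n - x) + vdot Q n, by linarith, by linarith, le_rfl, ?_⟩
    rw [stadium_of_ge hs hxy.le (by linarith), stadium_of_ge hs hxy.le (by linarith)]
    conv_rhs => rw [hb]
    module
  have hxn : x < n := by
    refine lt_of_le_of_ne hn.1 fun h => ?_
    rw [← h, hP] at hpq; linarith
  -- `G r` is the largest height over `[x, y]` of the curve point translated by `-b`. At direction
  -- `n` the translation does not change heights, so `G` is at least `s`; at the end point the
  -- translate is `P + a`, so `G` is at most `s`. Where `G = s`, the translate touches a tangent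
  -- line and is shown to lie on the curve.
  set G : ℝ → ℝ := fun r => sSup ((fun θ => hdot (stadium s x y r - b) θ) '' Icc x y) with hG
  have hGc : Continuous G := by
    apply isCompact_Icc.continuous_sSup
    exact continuous_hdot_uncurry.comp
      (((continuous_stadium.comp continuous_fst).sub continuous_const).prodMk continuous_snd)
  have hatt : ∀ r, ∃ θ ∈ Icc x y, G r = hdot (stadium s x y r - b) θ ∧
      ∀ θ' ∈ Icc x y, hdot (stadium s x y r - b) θ' ≤ hdot (stadium s x y r - b) θ := fun r =>
    isCompact_Icc.exists_sSup_image_eq_and_ge ⟨x, le_rfl, hxy.le⟩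
      (continuous_hdot _).continuousOn
  have htop : s ≤ G (s * (n - x)) := by
    obtain ⟨θ, -, h1, h2⟩ := hatt (s * (n - x))
    rw [h1]
    refine le_trans ?_ (h2 n hn)
    rw [stadium_arc hs hn.1 hn.2]; simp [hbn]
  have hbot : G (s * (y - x) + vdot Q y) ≤ s := by
    obtain ⟨θ, hθ, h1, -⟩ := hatt (s * (y - x) + vdot Q y)
    rw [h1, stadium_eq_right hs hxy.le hQ hQ']
    exact hV θ hθ
  have hle : s * (n - x) ≤ s * (y - x) + vdot Q y := by nlinarith
  obtain ⟨r₂, hr₂, hGr₂⟩ := intermediate_value_Icc' hle hGc.continuousOn ⟨hbot, htop⟩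
  obtain ⟨θ, hθ, h1, h2⟩ := hatt r₂
  rw [hGr₂] at h1
  rw [← h1] at h2
  set Y := stadium s x y r₂ - b with hY
  -- A maximizing angle beyond `n` would put the untranslated point above height `s`, contrary to
  -- `hdot_stadium_le`.
  have hθn : θ ≤ n := by
    by_contra! h
    have h3 := hdot_stadium_le hs hxy.le hy r₂ hθ
    have h4 : hdot (stadium s x y r₂) θ = s + B * sin (θ - n) := by
      have h5 : hdot b θ = B * sin (θ - n) := by
        conv_lhs => rw [hb]
        rw [hdot_smul, hdot_tvec]
      have h6 : hdot Y θ = hdot (stadium s x y r₂) θ - hdot b θ := hdot_sub _ _ _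
      linarith
    have := sin_pos_of_pos_of_lt_pi (x := θ - n) (by linarith) (by linarith [hθ.2])
    nlinarith
  have hYθ : Y = s • uvec θ + vdot Y θ • tvec θ := by
    rw [h1]; exact eq_dots Y θ
  have hvneg : vdot Y θ ≤ 0 := vdot_nonpos_of_le_right (lt_of_le_of_lt hθn hny) fun t ht => by
    rw [← h1]; exact h2 t ⟨hθ.1.trans ht.1.le, ht.2.le⟩
  have h0 : 0 ≤ s * (n - x) := mul_nonneg hs.le (by linarith)
  rcases hθ.1.eq_or_lt with hxθ | hxθ
  · subst hxθ
    refine ⟨vdot Y x, r₂, ?_, by linarith [hr₂.1], hr₂.2, ?_⟩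
    -- The translate lies on the initial tangent line; comparing heights in direction `n` shows that
    -- it does not come before `P`.
    · have h3 : hdot P n ≤ hdot Y n := by
        rw [hY, hdot_sub, hbn, sub_zero]
        exact hpq.trans (hdot_le_hdot_stadium hs hxy.le hy hQ hn hr₂.1 hr₂.2 hQ')
      rw [hdot_rotate P x n, hdot_rotate Y x n, hP, ← h1] at h3
      have := sin_pos_of_pos_of_lt_pi (x := n - x) (by linarith) (by linarith)
      exact le_of_mul_le_mul_right (by linarith) this
    · rw [stadium_of_nonpos hs hxy.le hvneg, ← hYθ, hY]; abel
  -- At an interior maximum both one-sided conditions hold, so the translate is the point of the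
  -- circle at angle `θ`.
  · have hv0 : vdot Y θ = 0 := le_antisymm hvneg <|
      vdot_nonneg_of_le_left hxθ fun t ht => by
        rw [← h1]; exact h2 t ⟨ht.1.le, ht.2.le.trans hθ.2⟩
    rw [hv0, zero_smul, add_zero] at hYθ
    have h5 : 0 ≤ s * (θ - x) := mul_nonneg hs.le (by linarith)
    refine ⟨s * (θ - x), r₂, by linarith, ?_, hr₂.2, ?_⟩
    · refine le_trans ?_ hr₂.1; gcongr
    · rw [stadium_arc hs hθ.1 hθ.2, ← hYθ, hY]; abel

/-- If the parallelogram lies inside the hull of the geodesic around the disc, then the geodesic can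
be divided among the two discs. -/
lemma Schedule.split (hs : 0 < s) (hxy : x < y) (hy : y ≤ x + π) (hP : hdot P x = s)
    (hQ : hdot (P + a + b) y = s) (hP' : vdot P x ≤ 0) (hQ' : 0 ≤ vdot (P + a + b) y)
    (hQx : hdot (P + a + b) x < s) (hV : ∀ θ ∈ Icc x y, hdot (P + a) θ ≤ s)
    (hW : ∀ θ ∈ Icc x y, hdot (P + b) θ ≤ s) :
    Schedule s P a b (‖a‖ + ‖b‖ + ∫ θ in x..y, excess s P a b θ) := by
  have hlx : x ∈ Icc x y := ⟨le_rfl, hxy.le⟩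
  have hly : y ∈ Icc x y := ⟨hxy.le, le_rfl⟩
  have hax : hdot a x ≤ 0 := by have := hV x hlx; simp at this; linarith
  have hbx : hdot b x ≤ 0 := by have := hW x hlx; simp at this; linarith
  have hay : 0 ≤ hdot a y := by have := hW y hly; simp at this hQ; linarith
  have hby : 0 ≤ hdot b y := by have := hV y hly; simp at this hQ; linarith
  have hlen := stadium_length_le (s := s) (P := P) hxy.le hy hax hbx hay hby
  have hd0 : 0 ≤ s * (y - x) := mul_nonneg hs.le (by linarith)
  refine Schedule.mono ?_ hlen
  have hchord : ∀ a' b' : Plane, P + a' + b' = P + a + b →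
      (∃ r₁ r₂, vdot P x ≤ r₁ ∧ r₁ ≤ r₂ ∧ r₂ ≤ s * (y - x) + vdot (P + a + b) y ∧
        stadium s x y r₂ - stadium s x y r₁ = b') →
      Schedule s P a' b' (-vdot P x + s * (y - x) + vdot (P + a + b) y) := by
    rintro a' b' hab ⟨r₁, r₂, h1, h2, h3, h4⟩
    have R := fun r r' (h : r ≤ r') => Reach.stadium hs hxy.le (by linarith [pi_pos]) h
    have R1 := R _ _ h1
    have R3 := R _ _ h3
    rw [stadium_eq_left hs hxy.le hP hP'] at R1
    rw [stadium_eq_right hs hxy.le hQ hQ'] at R3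
    refine ⟨_, _, _, _, s * (y - x) + vdot (P + a + b) y - r₂, by linarith, by linarith,
      by linarith, R1, R _ _ h2, ?_, Or.inr h4, by linarith⟩
    rwa [hab]
  have htriv : ∃ r₁ r₂, vdot P x ≤ r₁ ∧ r₁ ≤ r₂ ∧ r₂ ≤ s * (y - x) + vdot (P + a + b) y ∧
      stadium s x y r₂ - stadium s x y r₁ = 0 :=
    ⟨0, 0, hP', le_rfl, by linarith, by simp⟩
  by_cases hb0 : b = 0
  · exact hchord a b rfl (by simpa [hb0] using htriv)
  by_cases ha0 : a = 0
  · exact (hchord b a (by abel) (by simpa [ha0] using htriv)).swap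
  obtain ⟨na, ha1, ha2, ha⟩ := exists_tangential hxy hax hay
  obtain ⟨nb, hb1, hb2, hb⟩ := exists_tangential hxy hbx hby
  -- The chord is taken for the displacement whose tangential angle is larger: in that direction the
  -- other displacement has a nonnegative component, as `exists_stadium_chord` requires.
  rcases le_total na nb with h | h
  · refine hchord a b rfl (exists_stadium_chord hs hxy hy hP hQ hP' hQ' hQx hV ⟨hb1, hb2⟩ hb hb0 ?_)
    rw [ha, hdot_smul, hdot_tvec]
    exact mul_nonneg (norm_nonneg _)
      (sin_nonneg_of_nonneg_of_le_pi (by linarith) (by linarith))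
  · rw [add_right_comm] at hQ hQ' hQx
    have := exists_stadium_chord hs hxy hy hP hQ hP' hQ' hQx hW ⟨ha1, ha2⟩ ha ha0 (by
      rw [hb, hdot_smul, hdot_tvec]
      exact mul_nonneg (norm_nonneg _)
        (sin_nonneg_of_nonneg_of_le_pi (by linarith) (by linarith)))
    rw [add_right_comm] at this
    exact (hchord b a (by abel) this).swap

end Split

/-! ### Stepping aside when the two corners protrude at opposite ends. -/

section Detour

/-- Excludes the wrong side of a point of tangency. Expanding `h3` and inserting `h2` gives m² ≤ L²,
so m ≤ L; but c > -1 because S > 0, and then `h1` forces L < m. -/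
lemma detour_aux {s S c m L : ℝ} (hm : 0 < m) (hL : 0 < L) (hS : 0 < S) (hSc : S ^ 2 + c ^ 2 = 1)
    (h1 : L + m * c ≤ 0) (h2 : m ≤ s * S - L * c)
    (h3 : s ^ 2 ≤ (s - m * S) ^ 2 + (L + m * c) ^ 2) : False := by
  have h4 : m ^ 2 ≤ L ^ 2 := by nlinarith
  have h5 : m ≤ L := by nlinarith
  have h6 : -1 < c := by nlinarith
  nlinarith

variable {s x y θ₀ θ₁ : ℝ} {P a b : Plane}

set_option maxHeartbeats 1000000 in
/-- One disc makes room for the other one, and moves on after the other one has passed. -/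
lemma Schedule.detour (hs : 0 < s) (hP : P = ‖P‖ • uvec θ₀)
    (hQ : P + a + b = ‖P + a + b‖ • uvec θ₁) (hPs : s ≤ ‖P‖) (hQs : s ≤ ‖P + a + b‖)
    (h0x : θ₀ ≤ x) (hxy : x < y) (hy1 : y ≤ θ₁) (hy : y ≤ x + π)
    (hPge : ∀ θ ∈ Icc θ₀ x, s ≤ hdot P θ) (hQge : ∀ θ ∈ Icc y θ₁, s ≤ hdot (P + a + b) θ)
    (hPlt : ∀ θ ∈ Ioc x y, hdot P θ < s) (hQlt : ∀ θ ∈ Ico x y, hdot (P + a + b) θ < s)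
    (hQy : hdot (P + a + b) y = s)
    (hV : s < hdot (P + a) x) (hW : s < hdot (P + b) y) :
    Schedule s P a b (‖a‖ + ‖b‖ + ∫ θ in x..y, excess s P a b θ) := by
  set Q := P + a + b with hQdef
  have hsum : ∀ θ, hdot (P + a) θ + hdot (P + b) θ = hdot P θ + hdot Q θ := fun θ => by
    rw [hQdef]; simp; ring
  have hVy : hdot (P + a) y < s := by
    have := hsum y; have := hPlt y ⟨hxy, le_rfl⟩; linarith
  -- `x1` and `y2` are angles where the corners `P + a` and `P + b` have height exactly `s`. The sum
  -- of the heights of these corners equals that of `P` and `Q`, which puts `P + b` below `s` at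
  -- `x1` and allows `y2` to be found after `x1`.
  obtain ⟨x1, hx1, hVx1⟩ := intermediate_value_Icc' hxy.le (continuous_hdot (P + a)).continuousOn
    (show s ∈ Icc _ _ from ⟨hVy.le, hV.le⟩)
  have hxx1 : x < x1 := lt_of_le_of_ne hx1.1 fun h => by rw [← h] at hVx1; linarith
  have hx1y : x1 < y := lt_of_le_of_ne hx1.2 fun h => by rw [h] at hVx1; linarith
  have hPx1 : hdot P x1 < s := hPlt x1 ⟨hxx1, hx1.2⟩
  have hQx1 : hdot Q x1 < s := hQlt x1 ⟨hx1.1, hx1y⟩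
  have hWx1 : hdot (P + b) x1 < s := by linarith [hsum x1]
  obtain ⟨y2, hy2, hWy2⟩ := intermediate_value_Icc hx1.2 (continuous_hdot (P + b)).continuousOn
    (show s ∈ Icc _ _ from ⟨hWx1.le, hW.le⟩)
  have hx1y2 : x1 < y2 := lt_of_le_of_ne hy2.1 fun h => by rw [← h] at hWy2; linarith
  have hy2y : y2 < y := lt_of_le_of_ne hy2.2 fun h => by rw [h] at hWy2; linarith
  have hPy2 : hdot P y2 < s := hPlt y2 ⟨by linarith, hy2.2⟩
  have hQy2 : hdot Q y2 < s := hQlt y2 ⟨by linarith, hy2y⟩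
  have hax1 : hdot (P + a) x1 = hdot P x1 + hdot a x1 := hdot_add _ _ _
  have hay2 : hdot Q y2 = hdot (P + b) y2 + hdot a y2 := by rw [hQdef]; simp; ring
  have hbx1 : hdot Q x1 = hdot (P + a) x1 + hdot b x1 := hdot_add _ _ _
  have hby2 : hdot (P + b) y2 = hdot P y2 + hdot b y2 := hdot_add _ _ _
  have hapos : 0 < hdot a x1 := by linarith
  have haneg : hdot a y2 < 0 := by linarith
  set S := sin (y2 - x1) with hSdef
  set c := cos (y2 - x1) with hcdef
  have hSneg : sin (x1 - y2) = -S := by rw [hSdef, ← sin_neg]; ring_nf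
  have hcneg : cos (x1 - y2) = c := by rw [hcdef, ← cos_neg]; ring_nf
  have hS : 0 < S := sin_pos_of_pos_of_lt_pi (by linarith) (by linarith)
  have hSc : S ^ 2 + c ^ 2 = 1 := sin_sq_add_cos_sq _
  -- `m1` and `m2` are minus the coordinates of `a` in the basis `tvec x1`, `tvec y2`. The moves by
  -- `m2` and `m1` form the outer phases; they bring the ends of the middle phase onto the tangents
  -- at `x1` and `y2`.
  set m1 := -hdot a y2 / S with hm1
  set m2 := hdot a x1 / S with hm2
  have hm1S : m1 * S = -hdot a y2 := div_mul_cancel₀ _ hS.ne'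
  have hm2S : m2 * S = hdot a x1 := div_mul_cancel₀ _ hS.ne'
  have hm1p : 0 < m1 := div_pos (by linarith) hS
  have hm2p : 0 < m2 := div_pos hapos hS
  have ha : a = -(m1 • tvec x1) - m2 • tvec y2 := by
    apply ext_hdot (x := x1) (y := y2) hS.ne'
    · simp [hdot_tvec, hSneg]; linarith
    · simp [hdot_tvec]; linarith
  set X₁ := P - m2 • tvec y2 with hX₁
  set X₂ := Q + m1 • tvec x1 with hX₂
  have hX₁V : X₁ = P + a + m1 • tvec x1 := by rw [ha, hX₁]; module
  have hX₂W : X₂ = P + b - m2 • tvec y2 := by rw [hX₂, hQdef, ha]; module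
  have hX₂X₁ : X₂ - X₁ = b := by rw [hX₂W, hX₁]; module
  have hX₁x1 : hdot X₁ x1 = s := by rw [hX₁V]; simp at hVx1 ⊢; linarith
  have hX₂y2 : hdot X₂ y2 = s := by rw [hX₂W]; simp at hWy2 ⊢; linarith
  have hX₁y2 : hdot X₁ y2 = hdot P y2 := by rw [hX₁]; simp
  have hX₂x1 : hdot X₂ x1 = hdot Q x1 := by rw [hX₂]; simp
  have hPx1' : hdot P x1 = s - m2 * S := by linarith
  have hQy2' : hdot Q y2 = s - m1 * S := by linarith
  have hvPx1 : vdot P x1 = vdot X₁ x1 + m2 * c := by rw [hX₁]; simp [vdot_tvec, hcneg]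
  have hvQy2 : vdot Q y2 = vdot X₂ y2 - m1 * c := by rw [hX₂]; simp [vdot_tvec, ← hcdef]
  have hvPy2 : vdot P y2 = vdot X₁ x1 * c - s * S + m2 := by
    have h1 : vdot X₁ y2 = vdot P y2 - m2 := by rw [hX₁]; simp
    have h2 := vdot_rotate X₁ x1 y2
    rw [hX₁x1] at h2; linarith
  have hvQx1 : vdot Q x1 = vdot X₂ y2 * c + s * S - m1 := by
    have h1 : vdot X₂ x1 = vdot Q x1 + m1 := by rw [hX₂]; simp
    have h2 := vdot_rotate X₂ y2 x1
    rw [hX₂y2, hcneg, hSneg] at h2; linarith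
  have hvP : ∀ θ, vdot P θ = -(‖P‖ * sin (θ - θ₀)) := fun θ => by
    conv_lhs => rw [hP]
    rw [vdot_smul, vdot_uvec]; ring
  have hvQ : ∀ θ, vdot Q θ = ‖Q‖ * sin (θ₁ - θ) := fun θ => by
    conv_lhs => rw [hQ]
    rw [vdot_smul, vdot_uvec, ← sin_neg, neg_sub]
  have hsq : s ^ 2 ≤ ‖P‖ ^ 2 := by gcongr
  have hsq' : s ^ 2 ≤ ‖Q‖ ^ 2 := by gcongr
  have hc1 : -1 ≤ c := neg_one_le_cos _
  have first : Reach s 1 P X₁ m2 ∧ vdot X₁ x1 ≤ 0 := by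
    have hlen : ‖X₁ - P‖ = m2 := by
      rw [hX₁, sub_sub_cancel_left, norm_neg, norm_smul, norm_tvec, mul_one, Real.norm_eq_abs,
        abs_of_pos hm2p]
    -- Either the first move leads away from the origin, or `P` lies in the half-plane beyond the
    -- opposite tangent and moves parallel to its edge.
    rcases le_or_gt y2 (θ₀ + π) with h | h
    · have hs1 := sin_nonneg_of_nonneg_of_le_pi (x := y2 - θ₀) (by linarith) (by linarith)
      have hs2 := sin_nonneg_of_nonneg_of_le_pi (x := x1 - θ₀) (by linarith) (by linarith)
      have hv1 : vdot P x1 ≤ 0 := by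
        rw [hvP]; linarith [mul_nonneg (norm_nonneg P) hs2]
      have hv2 : vdot P y2 ≤ 0 := by
        rw [hvP]; linarith [mul_nonneg (norm_nonneg P) hs1]
      constructor
      · rw [← hlen]
        refine Reach.segment_of_inner (θ := y2 - π / 2) (r := m2) hm2p.le hPs ?_ ?_
        · rw [hdot_rotate P y2]; simp; linarith
        · rw [hX₁, sub_eq_add_neg, ← smul_neg]
          congr 2
          apply plane_ext <;> simp [cos_sub_pi_div_two, sin_sub_pi_div_two]
      · by_contra! hL
        refine detour_aux (s := s) hm2p hL hS hSc (by linarith) (by linarith) ?_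
        rw [norm_sq_eq_dots P x1, hPx1', hvPx1] at hsq
        exact hsq
    · have hp : hdot P y2 ≤ -s := by
        have := hPge (y2 - π) ⟨by linarith, by linarith⟩
        rw [hdot_sub_pi] at this; linarith
      constructor
      · rw [← hlen]
        refine Reach.segment_of_hdot (θ := y2 - π) ?_ ?_ <;> rw [hdot_sub_pi]
        · linarith
        · rw [hX₁y2]; linarith
      · rw [← hX₁y2, hdot_rotate X₁ x1 y2, hX₁x1] at hp
        by_contra! hL
        nlinarith [mul_pos hL hS]
  have last : Reach s 1 X₂ Q m1 ∧ 0 ≤ vdot X₂ y2 := by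
    have hlen : ‖X₂ - Q‖ = m1 := by
      rw [hX₂, add_sub_cancel_left, norm_smul, norm_tvec, mul_one, Real.norm_eq_abs,
        abs_of_pos hm1p]
    rcases le_or_gt θ₁ (x1 + π) with h | h
    · have hs1 := sin_nonneg_of_nonneg_of_le_pi (x := θ₁ - y2) (by linarith) (by linarith)
      have hs2 := sin_nonneg_of_nonneg_of_le_pi (x := θ₁ - x1) (by linarith) (by linarith)
      have hv1 : 0 ≤ vdot Q x1 := by rw [hvQ]; positivity
      have hv2 : 0 ≤ vdot Q y2 := by rw [hvQ]; positivity
      constructor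
      · rw [← hlen]
        refine (Reach.segment_of_inner (θ := x1 + π / 2) (r := m1) hm1p.le hQs ?_ ?_).reverse
        · rw [hdot_rotate Q x1]; simp; linarith
        · rw [hX₂]
          congr 2
          apply plane_ext <;> simp [cos_add_pi_div_two, sin_add_pi_div_two]
      · by_contra! hL
        refine detour_aux (s := s) (L := -vdot X₂ y2) hm1p (by linarith) hS hSc (by linarith)
          (by linarith) ?_
        rw [norm_sq_eq_dots Q y2, hQy2', hvQy2] at hsq'
        linarith
    · have hq : hdot Q x1 ≤ -s := by
        have := hQge (x1 + π) ⟨by linarith, by linarith⟩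
        rw [hdot_add_pi] at this; linarith
      constructor
      · rw [← hlen]
        refine (Reach.segment_of_hdot (θ := x1 + π) ?_ ?_).reverse <;> rw [hdot_add_pi]
        · linarith
        · rw [hX₂x1]; linarith
      · rw [← hX₂x1, hdot_rotate X₂ y2 x1, hX₂y2, hcneg, hSneg] at hq
        by_contra! hL
        nlinarith [mul_pos (neg_pos.2 hL) hS]
  have mid := reach_tangent hs hx1y2.le (by linarith) hX₁x1 first.2 hX₂y2 last.2
  have hd0 : 0 ≤ s * (y2 - x1) := mul_nonneg hs.le (by linarith)
  refine ⟨X₁, X₂, m2, _, m1, hm2p.le, by linarith [first.2, last.2], hm1p.le,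
    first.1.mono (by norm_num) le_rfl, mid, last.1.mono (by norm_num) le_rfl, Or.inr hX₂X₁, ?_⟩
  -- The same parallelogram is read from the corner `P + a` to the corner `P + b`. The middle phase
  -- is shorter than the bound for these corners by `m1 + m2`, exactly the cost of the outer phases.
  have hlen := stadium_length_le (s := s) (P := P + a) (a := -a) (b := b) hx1y2.le (by linarith)
    (by simp; linarith) (by linarith) (by simp; linarith) (by linarith)
  have hex : excess s (P + a) (-a) b = excess s P a b := by
    ext θ
    simp only [excess, supp, hdot_add, hdot_neg]
    congr 3
    rcases le_total 0 (hdot a θ) with h | h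
    · rw [max_eq_left h, max_eq_right (by linarith)]; ring
    · rw [max_eq_right h, max_eq_left (by linarith)]; ring
  rw [hex, norm_neg, show P + a + -a + b = P + b by abel] at hlen
  have hmono : ∫ θ in x1..y2, excess s P a b θ ≤ ∫ θ in x..y, excess s P a b θ :=
    intervalIntegral.integral_mono_interval hxx1.le hx1y2.le hy2y.le
      (Filter.Eventually.of_forall fun θ => excess_nonneg _ _ _ _ _)
      ((continuous_excess s P a b).intervalIntegrable _ _)
  have hvX₁ : vdot X₁ x1 = vdot (P + a) x1 + m1 := by rw [hX₁V]; simp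
  have hvX₂ : vdot X₂ y2 = vdot (P + b) y2 - m2 := by rw [hX₂W]; simp
  linarith

end Detour

/-! ### Case distinction and choice of the turning direction. -/

section Assembly

variable {s x y θ₀ θ₁ : ℝ} {P a b : Plane}

/-- The heights at `x`, `t` and `y` fix the signs of the components of `b` at `x` and `t`, and of
`a` at `t` and `y`. Signs persist between such angles because each interval is shorter than π. -/
lemma Schedule.geodesic_corner_of_lt (hs : 0 < s) (hy : y ≤ x + π)
    (hPx : hdot P x = s) (hQy : hdot (P + a + b) y = s)
    (hP : ∀ θ ∈ Icc x y, hdot P θ ≤ s) (hQ : ∀ θ ∈ Icc x y, hdot (P + a + b) θ ≤ s)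
    {t : ℝ} (ht : t ∈ Icc x y) (hV : s < hdot (P + a) t)
    (hWx : hdot (P + b) x ≤ s) (hWy : hdot (P + b) y ≤ s) :
    Schedule s P a b (‖a‖ + ‖b‖ + ∫ θ in x..y, excess s P a b θ) := by
  have h1 := hP t ht
  have h2 := hQ t ht
  simp only [hdot_add] at hPx hQy hV hWx hWy h1 h2
  have hbx : hdot b x ≤ 0 := by linarith
  have hbt : hdot b t < 0 := by linarith
  have hat : 0 < hdot a t := by linarith
  have hay : 0 ≤ hdot a y := by linarith
  have htx : t < x + π := lt_of_le_of_ne (ht.2.trans hy) fun h => by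
    rw [h, hdot_add_pi] at hbt; linarith
  have hyt : y < t + π := lt_of_le_of_ne (by linarith [ht.1]) fun h => by
    rw [h, hdot_add_pi] at hay; linarith
  refine Schedule.geodesic_corner hs ht.1 ht.2 hy hPx.ge (by simp; linarith) (by simp; linarith)
    (fun θ hθ => hdot_nonpos_between hθ.1 hθ.2 htx hbx hbt.le) fun θ hθ => ?_
  have := hdot_nonpos_between (Z := -a) hθ.1 hθ.2 hyt (by simp; linarith) (by simp; linarith)
  simpa using this

/-- The heights of the two middle corners add up to those of `P` and `Q`, so at most one corner
protrudes at each of `x` and `y`. Different corners at the two ends call for a detour, any other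
protrusion for a geodesic corner, and none for a split. -/
lemma Schedule.of_tangents (hs : 0 < s) (hP : P = ‖P‖ • uvec θ₀)
    (hQ : P + a + b = ‖P + a + b‖ • uvec θ₁) (hPs : s ≤ ‖P‖) (hQs : s ≤ ‖P + a + b‖)
    (h0x : θ₀ ≤ x) (hxy : x < y) (hy1 : y ≤ θ₁) (hy : y ≤ x + π)
    (hPge : ∀ θ ∈ Icc θ₀ x, s ≤ hdot P θ) (hQge : ∀ θ ∈ Icc y θ₁, s ≤ hdot (P + a + b) θ)
    (hPlt : ∀ θ ∈ Ioc x y, hdot P θ < s) (hQlt : ∀ θ ∈ Ico x y, hdot (P + a + b) θ < s)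
    (hPx : hdot P x = s) (hQy : hdot (P + a + b) y = s) :
    Schedule s P a b (‖a‖ + ‖b‖ + ∫ θ in x..y, excess s P a b θ) := by
  have hP' : ∀ θ ∈ Icc x y, hdot P θ ≤ s := fun θ hθ => by
    rcases hθ.1.eq_or_lt with h | h
    · rw [← h, hPx]
    · exact (hPlt θ ⟨h, hθ.2⟩).le
  have hQ' : ∀ θ ∈ Icc x y, hdot (P + a + b) θ ≤ s := fun θ hθ => by
    rcases hθ.2.eq_or_lt with h | h
    · rw [h, hQy]
    · exact (hQlt θ ⟨hθ.1, h⟩).le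
  have hQcomm : P + b + a = P + a + b := by abel
  have hcomm : (fun θ => excess s P b a θ) = fun θ => excess s P a b θ := excess_comm _ _ _ _
  have hswap : Schedule s P b a (‖b‖ + ‖a‖ + ∫ θ in x..y, excess s P b a θ) →
      Schedule s P a b (‖a‖ + ‖b‖ + ∫ θ in x..y, excess s P a b θ) := fun h => by
    rw [hcomm, add_comm ‖b‖] at h; exact h.swap
  have hlx : x ∈ Icc x y := ⟨le_rfl, hxy.le⟩
  have hly : y ∈ Icc x y := ⟨hxy.le, le_rfl⟩
  have hsumx : hdot (P + a) x + hdot (P + b) x < 2 * s := by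
    have := hQlt x ⟨le_rfl, hxy⟩; simp at this hPx ⊢; linarith
  have hsumy : hdot (P + a) y + hdot (P + b) y < 2 * s := by
    have := hPlt y ⟨hxy, le_rfl⟩; simp at this hQy ⊢; linarith
  have cornerV : ∀ t ∈ Icc x y, s < hdot (P + a) t → hdot (P + b) x ≤ s → hdot (P + b) y ≤ s →
      Schedule s P a b (‖a‖ + ‖b‖ + ∫ θ in x..y, excess s P a b θ) :=
    fun t ht => Schedule.geodesic_corner_of_lt hs hy hPx hQy hP' hQ' ht
  have cornerW : ∀ t ∈ Icc x y, s < hdot (P + b) t → hdot (P + a) x ≤ s → hdot (P + a) y ≤ s →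
      Schedule s P a b (‖a‖ + ‖b‖ + ∫ θ in x..y, excess s P a b θ) := fun t ht h1 h2 h3 =>
    hswap <| Schedule.geodesic_corner_of_lt hs hy hPx (by rwa [hQcomm]) hP' (by rwa [hQcomm])
      ht h1 h2 h3
  rcases le_or_gt (hdot (P + a) x) s with hVx | hVx
  · rcases le_or_gt (hdot (P + a) y) s with hVy | hVy
    · by_cases hW : ∃ t ∈ Icc x y, s < hdot (P + b) t
      · obtain ⟨t, ht, hWt⟩ := hW
        exact cornerW t ht hWt hVx hVy
      push Not at hW
      by_cases hV : ∃ t ∈ Icc x y, s < hdot (P + a) t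
      · obtain ⟨t, ht, hVt⟩ := hV
        exact cornerV t ht hVt (hW x hlx) (hW y hly)
      push Not at hV
      have hvP : vdot P x ≤ 0 := vdot_nonpos_of_le_right hxy fun t ht => by
        rw [hPx]; exact hP' t ⟨ht.1.le, ht.2.le⟩
      have hvQ : 0 ≤ vdot (P + a + b) y := vdot_nonneg_of_le_left hxy fun t ht => by
        rw [hQy]; exact hQ' t ⟨ht.1.le, ht.2.le⟩
      exact Schedule.split hs hxy hy hPx hQy hvP hvQ (hQlt x ⟨le_rfl, hxy⟩) hV hW
    · rcases le_or_gt (hdot (P + b) x) s with hWx | hWx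
      · exact cornerV y hly hVy hWx (by linarith)
      · refine hswap (Schedule.detour hs hP ?_ hPs ?_ h0x hxy hy1 hy hPge ?_ hPlt ?_ ?_ hWx hVy)
        all_goals rwa [hQcomm]
  · rcases le_or_gt (hdot (P + b) y) s with hWy | hWy
    · exact cornerV x hlx hVx (by linarith) hWy
    · exact Schedule.detour hs hP hQ hPs hQs h0x hxy hy1 hy hPge hQge hPlt hQlt hQy hVx hWy

/-- The last angle at which a vector of length `r` reaches at least height `s`. -/
lemma exists_last_ge {s r L : ℝ} (hs : 0 < s) (hr : s ≤ r) (hL : 0 ≤ L) (hL' : L < π + π / 2) :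
    ∃ t, 0 ≤ t ∧ t ≤ L ∧ (∀ u, 0 ≤ u → u ≤ t → s ≤ r * cos u) ∧
      (∀ u, t < u → u ≤ L → r * cos u < s) ∧ (t < L → r * cos t = s) := by
  have hr0 : 0 < r := hs.trans_le hr
  have hle : s / r ≤ 1 := (div_le_one hr0).2 hr
  have hpos : 0 < s / r := div_pos hs hr0
  set φ := arccos (s / r) with hφ
  have hφ0 : 0 ≤ φ := arccos_nonneg _
  have hφ1 : φ < π / 2 := arccos_lt_pi_div_two.2 hpos
  have hcos : r * cos φ = s := by
    rw [hφ, cos_arccos (by linarith) hle, mul_div_cancel₀ _ hr0.ne']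
  -- The angle is arccos (s / r), cut off at `L`. As `L` is below 3π/2, the cosine does not become
  -- positive again.
  refine ⟨min φ L, le_min hφ0 hL, min_le_right _ _, fun u h0 h1 => ?_, fun u h0 h1 => ?_,
    fun h => ?_⟩
  · rw [← hcos]
    exact mul_le_mul_of_nonneg_left (cos_le_cos_of_nonneg_of_le_pi h0 (by linarith [pi_pos])
      (h1.trans (min_le_left _ _))) hr0.le
  · have hu : φ < u := by
      rcases min_lt_iff.1 h0 with h | h
      · exact h
      · linarith
    rcases le_or_gt u (π / 2) with h | h
    · rw [← hcos]
      exact mul_lt_mul_of_pos_left (cos_lt_cos_of_nonneg_of_le_pi hφ0 (by linarith [pi_pos]) hu) hr0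
    · exact (mul_nonpos_of_nonneg_of_nonpos hr0.le
        (cos_nonpos_of_pi_div_two_le_of_le h.le (by linarith))).trans_lt hs
  · rcases le_total φ L with h' | h'
    · rw [min_eq_left h', hcos]
    · rw [min_eq_right h'] at h; exact absurd h (lt_irrefl _)

/-- The cost of a motion that turns from direction `θ₀` to direction `θ₁` is attained, if the
turning angle is at most `π`, or if one end point lies far behind the other one. -/
theorem Schedule.of_arc (hs : 0 < s) (hP : P = ‖P‖ • uvec θ₀)
    (hQ : P + a + b = ‖P + a + b‖ • uvec θ₁) (hPs : s ≤ ‖P‖) (hQs : s ≤ ‖P + a + b‖)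
    (h01 : θ₀ ≤ θ₁)
    (hturn : θ₁ ≤ θ₀ + π ∨ (θ₁ ≤ θ₀ + 2 * π ∧
      (hdot P θ₁ < -‖P + a + b‖ ∨ hdot (P + a + b) θ₀ < -‖P‖))) :
    Schedule s P a b (‖a‖ + ‖b‖ + ∫ θ in θ₀..θ₁, excess s P a b θ) := by
  have hp : ∀ θ, hdot P θ = ‖P‖ * cos (θ - θ₀) := fun θ => by
    conv_lhs => rw [hP]
    rw [hdot_smul, hdot_uvec]
  have hq : ∀ θ, hdot (P + a + b) θ = ‖P + a + b‖ * cos (θ₁ - θ) := fun θ => by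
    conv_lhs => rw [hQ]
    rw [hdot_smul, hdot_uvec, ← cos_neg, neg_sub]
  set Q := P + a + b with hQdef
  have hP0 : 0 < ‖P‖ := hs.trans_le hPs
  have hQ0 : 0 < ‖Q‖ := hs.trans_le hQs
  have hL : θ₁ - θ₀ < π + π / 2 := by
    rcases hturn with h | ⟨h, h'⟩
    · linarith [pi_pos]
    · by_contra! hc
      have : 0 ≤ cos (θ₁ - θ₀) := by
        rw [← cos_sub_two_pi]
        exact cos_nonneg_of_neg_pi_div_two_le_of_le (by linarith) (by linarith [pi_pos])
      rw [hp, hq] at h'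
      rcases h' with h' | h'
      · linarith [mul_nonneg hP0.le this]
      · linarith [mul_nonneg hQ0.le this]
  obtain ⟨t, ht0, htL, ht1, ht2, ht3⟩ := exists_last_ge hs hPs (sub_nonneg.2 h01) hL
  obtain ⟨u, hu0, huL, hu1, hu2, hu3⟩ := exists_last_ge hs hQs (sub_nonneg.2 h01) hL
  have hPge : ∀ θ ∈ Icc θ₀ (θ₀ + t), s ≤ hdot P θ := fun θ hθ => by
    rw [hp]; exact ht1 _ (by linarith [hθ.1]) (by linarith [hθ.2])
  have hQge : ∀ θ ∈ Icc (θ₁ - u) θ₁, s ≤ hdot Q θ := fun θ hθ => by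
    rw [hq]; exact hu1 _ (by linarith [hθ.2]) (by linarith [hθ.1])
  rcases le_or_gt (θ₁ - u) (θ₀ + t) with h | hxy
  · have hnn : 0 ≤ ∫ θ in θ₀..θ₁, excess s P a b θ :=
      intervalIntegral.integral_nonneg h01 fun θ _ => excess_nonneg _ _ _ _ _
    have h1 := hPge (θ₀ + t) ⟨by linarith, le_rfl⟩
    have h2 := hQge (θ₀ + t) ⟨h, by linarith⟩
    rcases le_total s (hdot (P + a) (θ₀ + t)) with h3 | h3
    · exact (Schedule.straight h1 h3 h2).mono (by linarith)
    · have h4 : s ≤ hdot (P + b) (θ₀ + t) := by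
        rw [hQdef] at h2; simp at h2 h3 ⊢; linarith
      have h5 : s ≤ hdot (P + b + a) (θ₀ + t) := by rwa [add_right_comm]
      exact (Schedule.straight h1 h4 h5).swap.mono (by linarith)
  · have hPlt : ∀ θ ∈ Ioc (θ₀ + t) (θ₁ - u), hdot P θ < s := fun θ hθ => by
      rw [hp]; exact ht2 _ (by linarith [hθ.1]) (by linarith [hθ.2])
    have hQlt : ∀ θ ∈ Ico (θ₀ + t) (θ₁ - u), hdot Q θ < s := fun θ hθ => by
      rw [hq]; exact hu2 _ (by linarith [hθ.2]) (by linarith [hθ.1])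
    have hPx : hdot P (θ₀ + t) = s := by
      rw [hp, add_sub_cancel_left]; exact ht3 (by linarith)
    have hQy : hdot Q (θ₁ - u) = s := by
      rw [hq, sub_sub_cancel]; exact hu3 (by linarith)
    -- A gap above π is possible only in the second case of `hturn`. Then the end point lying far
    -- behind the other still has height above `s` at an angle inside the gap, a contradiction.
    have hy : θ₁ - u ≤ θ₀ + t + π := by
      by_contra! hc
      rcases hturn with h | ⟨h, h' | h'⟩
      · linarith
      · set θ := (θ₀ + t + (θ₁ - u - π)) / 2 with hθ
        have h1 := hPlt θ ⟨by linarith, by linarith [pi_pos]⟩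
        rw [hp] at h' h1
        have h2 : cos (θ₁ - π - θ₀) ≤ cos (θ - θ₀) :=
          cos_le_cos_of_nonneg_of_le_pi (by linarith) (by linarith) (by linarith)
        rw [show θ₁ - θ₀ = θ₁ - π - θ₀ + π by ring, cos_add_pi] at h'
        nlinarith
      · set θ := (θ₀ + t + π + (θ₁ - u)) / 2 with hθ
        have h1 := hQlt θ ⟨by linarith [pi_pos], by linarith⟩
        rw [hq] at h' h1
        have h2 : cos (θ₁ - π - θ₀) ≤ cos (θ₁ - θ) :=
          cos_le_cos_of_nonneg_of_le_pi (by linarith) (by linarith) (by linarith)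
        rw [show θ₁ - θ₀ = θ₁ - π - θ₀ + π by ring, cos_add_pi] at h'
        nlinarith
    refine (Schedule.of_tangents hs hP hQ hPs hQs (by linarith) hxy (by linarith) hy hPge hQge hPlt
      hQlt hPx hQy).mono ?_
    have := intervalIntegral.integral_mono_interval (μ := MeasureTheory.volume)
      (f := excess s P a b) (by linarith : θ₀ ≤ θ₀ + t) hxy.le (by linarith : θ₁ - u ≤ θ₁)
      (Filter.Eventually.of_forall fun θ => excess_nonneg _ _ _ _ _)
      ((continuous_excess s P a b).intervalIntegrable _ _)
    linarith

/-- The parallelogram is the same when read from its opposite vertex. -/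
lemma excess_reverse (s : ℝ) (P a b : Plane) :
    excess s (P + a + b) (-a) (-b) = excess s P a b := by
  ext θ
  simp only [excess, supp, hdot_add, hdot_neg]
  have h : ∀ z : ℝ, max (-z) 0 = max z 0 - z := fun z => by
    rcases le_total 0 z with h | h
    · rw [max_eq_left h, max_eq_right (by linarith)]; ring
    · rw [max_eq_right h, max_eq_left (by linarith)]; ring
  rw [h, h]
  congr 2; ring

/-- Turning by the smaller angle is cheaper, unless one end point lies far behind the other one. -/
lemma integral_excess_le (hP : P = ‖P‖ • uvec θ₀) (hQ : P + a + b = ‖P + a + b‖ • uvec θ₁)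
    (h01 : θ₀ + π < θ₁) (h10 : θ₁ ≤ θ₀ + 2 * π) (h1 : -‖P + a + b‖ ≤ hdot P θ₁)
    (h2 : -‖P‖ ≤ hdot (P + a + b) θ₀) :
    ∫ θ in θ₁..θ₀ + 2 * π, excess s P a b θ ≤ ∫ θ in θ₀..θ₁, excess s P a b θ := by
  set Q := P + a + b with hQdef
  have hpp : hdot P θ₀ = ‖P‖ := by nth_rw 1 [hP]; simp
  have hqq : hdot Q θ₁ = ‖Q‖ := by nth_rw 1 [hQ]; simp
  have hc := continuous_excess s P a b
  -- The supports at `θ` and `θ - π` differ by the component of `P + Q`, twice the centre of the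
  -- parallelogram. It is nonnegative at both ends of the smaller arc, hence throughout.
  have hpt : ∀ θ ∈ Icc θ₁ (θ₀ + 2 * π), excess s P a b θ ≤ excess s P a b (θ - π) := fun θ hθ => by
    have hpos : hdot (-(P + Q)) θ ≤ 0 := by
      refine hdot_nonpos_between hθ.1 hθ.2 (by linarith) ?_ ?_
      · simp; linarith
      · rw [hdot_add_two_pi]; simp; linarith
    have e1 : hdot Q θ = hdot P θ + hdot a θ + hdot b θ := by rw [hQdef]; simp
    have h : ∀ z : ℝ, max (-z) 0 = max z 0 - z := fun z => by
      rcases le_total 0 z with h | h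
      · rw [max_eq_left h, max_eq_right (by linarith)]; ring
      · rw [max_eq_right h, max_eq_left (by linarith)]; ring
    simp only [excess, supp, hdot_sub_pi, h]
    simp at hpos
    exact max_le_max (by linarith) le_rfl
  calc ∫ θ in θ₁..θ₀ + 2 * π, excess s P a b θ
      ≤ ∫ θ in θ₁..θ₀ + 2 * π, excess s P a b (θ - π) :=
        intervalIntegral.integral_mono_on h10 (hc.intervalIntegrable _ _)
          ((hc.comp (by fun_prop)).intervalIntegrable _ _) hpt
    _ = ∫ θ in θ₁ - π..θ₀ + 2 * π - π, excess s P a b θ :=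
        intervalIntegral.integral_comp_sub_right _ _
    _ ≤ ∫ θ in θ₀..θ₁, excess s P a b θ :=
        intervalIntegral.integral_mono_interval (by linarith) (by linarith) (by linarith)
          (Filter.Eventually.of_forall fun θ => excess_nonneg _ _ _ _ _)
          (hc.intervalIntegrable _ _)

/-- The clockwise turn from `P` to `Q` is the time reversal of the counter-clockwise turn from `Q`
to `P`. -/
lemma Schedule.of_reflex_arc (hs : 0 < s) (hP : P = ‖P‖ • uvec θ₀)
    (hQ : P + a + b = ‖P + a + b‖ • uvec θ₁) (hPs : s ≤ ‖P‖) (hQs : s ≤ ‖P + a + b‖)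
    (h10 : θ₁ ≤ θ₀ + 2 * π) (hlarge : θ₀ + π ≤ θ₁) :
    Schedule s P a b (‖a‖ + ‖b‖ + ∫ θ in θ₁..θ₀ + 2 * π, excess s P a b θ) := by
  have hback : P + a + b + -a + -b = P := by abel
  have hP2 : P = ‖P‖ • uvec (θ₀ + 2 * π) := by
    rw [uvec, cos_add_two_pi, sin_add_two_pi]; exact hP
  have := Schedule.of_arc (a := -a) (b := -b) hs hQ (by rwa [hback]) hQs (by rwa [hback]) h10
    (Or.inl (by linarith))
  rw [excess_reverse, norm_neg, norm_neg] at this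
  exact this.reverse

lemma Schedule.exists_of_lt (hs : 0 < s) (hP : P = ‖P‖ • uvec θ₀)
    (hQ : P + a + b = ‖P + a + b‖ • uvec θ₁) (hPs : s ≤ ‖P‖) (hQs : s ≤ ‖P + a + b‖)
    (h01 : θ₀ ≤ θ₁) (h10 : θ₁ ≤ θ₀ + 2 * π) (hlarge : θ₀ + π < θ₁) :
    ∃ ℓ, Schedule s P a b ℓ ∧ ℓ ≤ ‖a‖ + ‖b‖ + ∫ θ in θ₀..θ₁, excess s P a b θ ∧
      ℓ ≤ ‖a‖ + ‖b‖ + ∫ θ in θ₁..θ₀ + 2 * π, excess s P a b θ := by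
  have small := Schedule.of_reflex_arc hs hP hQ hPs hQs h10 hlarge.le
  rcases le_total (∫ θ in θ₁..θ₀ + 2 * π, excess s P a b θ)
    (∫ θ in θ₀..θ₁, excess s P a b θ) with h | h
  · exact ⟨_, small, by linarith, le_rfl⟩
  by_cases hN : hdot P θ₁ < -‖P + a + b‖ ∨ hdot (P + a + b) θ₀ < -‖P‖
  · exact ⟨_, Schedule.of_arc hs hP hQ hPs hQs h01 (Or.inr ⟨h10, hN⟩), le_rfl, by linarith⟩
  push Not at hN
  have := integral_excess_le (s := s) hP hQ hlarge h10 hN.1 hN.2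
  exact ⟨_, small, by linarith, le_rfl⟩

/-- There is a schedule that is as cheap as both ways of turning. -/
theorem Schedule.exists (hs : 0 < s) (hP : P = ‖P‖ • uvec θ₀)
    (hQ : P + a + b = ‖P + a + b‖ • uvec θ₁) (hPs : s ≤ ‖P‖) (hQs : s ≤ ‖P + a + b‖)
    (h01 : θ₀ ≤ θ₁) (h10 : θ₁ ≤ θ₀ + 2 * π) :
    ∃ ℓ, Schedule s P a b ℓ ∧ ℓ ≤ ‖a‖ + ‖b‖ + ∫ θ in θ₀..θ₁, excess s P a b θ ∧
      ℓ ≤ ‖a‖ + ‖b‖ + ∫ θ in θ₁..θ₀ + 2 * π, excess s P a b θ := by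
  have hback : P + a + b + -a + -b = P := by abel
  have hP2 : P = ‖P‖ • uvec (θ₀ + 2 * π) := by
    rw [uvec, cos_add_two_pi, sin_add_two_pi]; exact hP
  rcases lt_or_ge (θ₀ + π) θ₁ with h | h
  · exact Schedule.exists_of_lt hs hP hQ hPs hQs h01 h10 h
  have small := Schedule.of_arc hs hP hQ hPs hQs h01 (Or.inl h)
  have hper : ∫ θ in θ₀ + 2 * π..θ₁ + 2 * π, excess s P a b θ = ∫ θ in θ₀..θ₁, excess s P a b θ := by
    rw [← intervalIntegral.integral_comp_add_right]
    simp only [excess, supp, hdot_add_two_pi]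
  -- At exactly a half turn both bounds are attained and the smaller one is taken; below it,
  -- exchanging the end points makes the other turn the counter-clockwise one.
  rcases h.eq_or_lt with h | h
  · have big := Schedule.of_reflex_arc hs hP hQ hPs hQs h10 h.ge
    rcases le_total (∫ θ in θ₁..θ₀ + 2 * π, excess s P a b θ)
      (∫ θ in θ₀..θ₁, excess s P a b θ) with h' | h'
    · exact ⟨_, big, by linarith, le_rfl⟩
    · exact ⟨_, small, le_rfl, by linarith⟩
  have := Schedule.exists_of_lt (a := -a) (b := -b) hs hQ (by rwa [hback]) hQs (by rwa [hback]) h10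
    (by linarith) (by linarith)
  rw [excess_reverse, norm_neg, norm_neg, hper] at this
  obtain ⟨ℓ, h1, h2, h3⟩ := this
  exact ⟨ℓ, h1.reverse, h3, h2⟩

end Assembly

/-! ### From a schedule to a motion of the two discs. -/

/-- Each phase occupies a third of the time. One curve takes the increments of the outer phases, the
other that of the middle phase, and clamping makes each rest while the other moves. -/
lemma exists_combined {s : ℝ} {f₁ f₂ f₃ : I → Plane} {n₁ n₂ n₃ : ℕ}
    (c₁ : Continuous f₁) (c₂ : Continuous f₂) (c₃ : Continuous f₃)
    (h₁₂ : f₁ 1 = f₂ 0) (h₂₃ : f₂ 1 = f₃ 0)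
    (a₁ : ∀ t, s ≤ ‖f₁ t‖) (a₂ : ∀ t, s ≤ ‖f₂ t‖) (a₃ : ∀ t, s ≤ ‖f₃ t‖)
    (p₁ : Pieces s f₁ n₁ 0 1) (p₂ : Pieces s f₂ n₂ 0 1) (p₃ : Pieces s f₃ n₃ 0 1) :
    ∃ g h : I → Plane, Continuous g ∧ Continuous h ∧ g 0 = 0 ∧ h 0 = 0 ∧
      h 1 = f₂ 1 - f₂ 0 ∧ g 1 = f₃ 1 - f₁ 0 - h 1 ∧
      (∀ t, s ≤ ‖f₁ 0 + g t + h t‖) ∧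
      eVariationOn g univ ≤ eVariationOn f₁ univ + eVariationOn f₃ univ ∧
      eVariationOn h univ ≤ eVariationOn f₂ univ ∧
      Pieces s g (n₁ + n₃) 0 1 ∧ Pieces s h n₂ 0 1 ∧
      ∃ u v : I, u ≤ v ∧ AtRest h 0 u ∧ AtRest g u v ∧ AtRest h v 1 := by
  set u : I := ⟨1 / 3, by norm_num, by norm_num⟩ with hu
  set v : I := ⟨2 / 3, by norm_num, by norm_num⟩ with hv
  have hm := fun d => monotone_ramp (show (0 : ℝ) ≤ 3 by norm_num) d
  have hc := fun d => continuous_ramp 3 d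
  have l0 : (0 : I) ≤ v := unitInterval.nonneg'
  have l1 : v ≤ 1 := unitInterval.le_one'
  have m0 : ∀ d : ℝ, 0 ≤ d → ramp 3 d 0 = 0 := fun d hd => ramp_eq_zero (by simpa using hd)
  have m1 : ∀ d : ℝ, d ≤ 2 → ramp 3 d 1 = 1 := fun d hd =>
    ramp_eq_one (by rw [Set.Icc.coe_one]; linarith)
  have z1 : ∀ t ≤ u, ramp 3 1 t = 0 := fun t ht => ramp_eq_zero (by
    have : (t : ℝ) ≤ 1 / 3 := ht
    linarith)
  have z2 : ∀ t ≤ v, ramp 3 2 t = 0 := fun t ht => ramp_eq_zero (by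
    have : (t : ℝ) ≤ 2 / 3 := ht
    linarith)
  have o0 : ∀ t, u ≤ t → ramp 3 0 t = 1 := fun t ht => ramp_eq_one (by
    have : 1 / 3 ≤ (t : ℝ) := ht
    linarith)
  have o1 : ∀ t, v ≤ t → ramp 3 1 t = 1 := fun t ht => ramp_eq_one (by
    have : 2 / 3 ≤ (t : ℝ) := ht
    linarith)
  have huv : u ≤ v := show (1 / 3 : ℝ) ≤ 2 / 3 by norm_num
  set g : I → Plane := fun t => (f₁ (ramp 3 0 t) - f₁ 0) + (f₃ (ramp 3 2 t) - f₃ 0) with hg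
  set h : I → Plane := fun t => f₂ (ramp 3 1 t) - f₂ 0 with hh
  have g1 : ∀ t ∈ Icc 0 v, g t = (1 : ℝ) • f₁ (ramp 3 0 t) + -f₁ 0 := fun t ht => by
    simp only [hg]; rw [z2 t ht.2]; module
  have g2 : ∀ t ∈ Icc v 1, g t = (1 : ℝ) • f₃ (ramp 3 2 t) + (f₁ 1 - f₁ 0 - f₃ 0) := fun t ht => by
    simp only [hg]; rw [o0 t (huv.trans ht.1)]; module
  have h1 : ∀ t, h t = (1 : ℝ) • f₂ (ramp 3 1 t) + -f₂ 0 := fun t => by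
    simp only [hh]; module
  refine ⟨g, h, ?_, ?_, ?_, ?_, ?_, ?_, fun t => ?_, ?_, ?_, ?_, ?_, u, v, huv, ?_, ?_, ?_⟩
  · exact ((c₁.comp (hc 0)).sub continuous_const).add ((c₃.comp (hc 2)).sub continuous_const)
  · exact (c₂.comp (hc 1)).sub continuous_const
  · simp only [hg]; rw [m0 0 le_rfl, m0 2 (by norm_num)]; simp
  · simp only [hh]; rw [m0 1 (by norm_num)]; simp
  · simp only [hh]; rw [m1 1 (by norm_num)]
  · simp only [hg, hh]
    rw [m1 0 (by norm_num), m1 2 le_rfl, m1 1 (by norm_num), h₁₂, h₂₃]; abel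
  · simp only [hg, hh]
    rcases le_total t u with ht | ht
    · rw [z1 t ht, z2 t (ht.trans huv)]
      convert a₁ (ramp 3 0 t) using 2; abel
    rw [o0 t ht]
    rcases le_total t v with ht' | ht'
    · rw [z2 t ht', h₁₂]
      convert a₂ (ramp 3 1 t) using 2; abel
    · rw [o1 t ht', h₁₂, h₂₃]
      convert a₃ (ramp 3 2 t) using 2; abel
  · rw [eVariationOn_univ_split g v]
    exact add_le_add (eVariationOn_transform_le (Or.inl rfl) (hm 0) g1)
      (eVariationOn_transform_le (Or.inl rfl) (hm 2) g2)
  · exact eVariationOn_transform_le (Or.inl rfl) (hm 1) fun t _ => h1 t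
  · exact (p₁.transform (Or.inl rfl) (hm 0) (hc 0) l0 (m0 0 le_rfl) (o0 v huv) g1).append
      (p₃.transform (Or.inl rfl) (hm 2) (hc 2) l1 (z2 v le_rfl) (m1 2 le_rfl) g2)
  · exact p₂.transform (Or.inl rfl) (hm 1) (hc 1) zero_le_one (m0 1 (by norm_num))
      (m1 1 (by norm_num)) fun t _ => h1 t
  · intro t ht
    simp only [hh]; rw [z1 t ht.2, m0 1 (by norm_num)]
  · intro t ht
    simp only [hg]; rw [o0 t ht.1, o0 u le_rfl, z2 t ht.2, z2 u huv]
  · intro t ht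
    simp only [hh]; rw [o1 t ht.1, o1 v le_rfl]

lemma Trajectory.composedOfAtMost {s : ℝ} {p q : Plane} {N n : ℕ} {ξ : Trajectory p q} (hn : n ≤ N)
    (h : Pieces s ξ.toPath n 0 1) : ξ.ComposedOfAtMost s N := by
  obtain ⟨τ, h1, h2, h3, h4⟩ := h.exists_subdivision
  exact ⟨n, hn, τ, ⟨h1, h2, h3⟩, h4⟩

lemma isSubdivision_of_le {u v : I} (h : u ≤ v) : IsSubdivision ![0, u, v, 1] := by
  refine ⟨?_, rfl, rfl⟩
  rw [Fin.monotone_iff_le_succ]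
  intro i
  fin_cases i
  exacts [unitInterval.nonneg', h, unitInterval.le_one']

lemma exists_trajectory {s : ℝ} {p q : Plane} {n N : ℕ} {ε : ℝ} (hε : ε = 1 ∨ ε = -1)
    {f : I → Plane} (hf : Continuous f) (h0 : f 0 = 0) (h1 : p + ε • f 1 = q)
    (hb : eVariationOn f univ ≠ ⊤) (hn : n ≤ N) (h : Pieces s f n 0 1) :
    ∃ ξ : Trajectory p q, (∀ t, ξ.toPath t = p + ε • f t) ∧ ξ.length ≤ eVariationOn f univ ∧
      ξ.ComposedOfAtMost s N ∧ ∀ u v, AtRest f u v → AtRest ξ.toPath u v := by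
  have hv : eVariationOn (fun t => p + ε • f t) univ ≤ eVariationOn f univ :=
    eVariationOn_transform_le (m := id) (w := p) hε monotone_id fun t _ => add_comm _ _
  refine ⟨⟨⟨⟨fun t => p + ε • f t, continuous_const.add (hf.const_smul ε)⟩, by simp [h0], h1⟩,
    ne_top_of_le_ne_top hb hv⟩, fun _ => rfl, hv, Trajectory.composedOfAtMost hn <|
    h.transform (m := id) (w := p) hε monotone_id continuous_id zero_le_one rfl rfl
      fun t _ => add_comm _ _, fun u v huv t ht => ?_⟩
  change p + ε • f t = p + ε • f u
  rw [huv t ht]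

/-- A schedule for the relative position yields a decoupled motion of the two discs. -/
theorem Schedule.exists_motion {s ℓ : ℝ} {P₀ P₁ : Placement}
    (h : Schedule s (P₀.A - P₀.B) (P₁.A - P₀.A) (P₀.B - P₁.B) ℓ) :
    ∃ m : Motion P₀ P₁, m.Compatible s ∧ m.length ≤ ENNReal.ofReal ℓ ∧
      m.trajA.ComposedOfAtMost s 6 ∧ m.trajB.ComposedOfAtMost s 6 ∧ m.Decoupled := by
  obtain ⟨X₁, X₂, ℓ₁, ℓ₂, ℓ₃, hℓ₁, hℓ₂, hℓ₃, r₁, r₂, r₃, hX, hℓ⟩ := h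
  obtain ⟨f₁, c₁, s₁, e₁, a₁, v₁, n₁, hn₁, p₁⟩ := r₁
  obtain ⟨f₂, c₂, s₂, e₂, a₂, v₂, n₂, hn₂, p₂⟩ := r₂
  obtain ⟨f₃, c₃, s₃, e₃, a₃, v₃, n₃, hn₃, p₃⟩ := r₃
  obtain ⟨g, h, cg, ch, g0, h0, h1, g1, ha, vg, vh, pg, ph, u, v, huv, ru, rv, rr⟩ :=
    exists_combined c₁ c₂ c₃ (e₁.trans s₂.symm) (e₂.trans s₃.symm) a₁ a₂ a₃ p₁ p₂ p₃
  have vg' : eVariationOn g univ ≤ ENNReal.ofReal (ℓ₁ + ℓ₃) := by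
    rw [ENNReal.ofReal_add hℓ₁ hℓ₃]; exact vg.trans (add_le_add v₁ v₃)
  have vh' := vh.trans v₂
  have bg := ne_top_of_le_ne_top ENNReal.ofReal_ne_top vg'
  have bh := ne_top_of_le_ne_top ENNReal.ofReal_ne_top vh'
  have vgh : eVariationOn g univ + eVariationOn h univ ≤ ENNReal.ofReal ℓ := by
    refine (add_le_add vg' vh').trans ?_
    rw [← ENNReal.ofReal_add (by positivity) hℓ₂]
    exact ENNReal.ofReal_le_ofReal (by linarith)
  -- Two outer phases of at most three pieces each account for the number six.
  have ng : n₁ + n₃ ≤ 6 := by omega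
  have nh : n₂ ≤ 6 := by omega
  rw [e₂, s₂] at h1
  rw [e₃, s₁, h1] at g1
  rcases hX with hX | hX
  · rw [hX] at h1 g1
    obtain ⟨ξ, ξt, ξl, ξc, ξr⟩ := exists_trajectory (p := P₀.A) (q := P₁.A) (Or.inl rfl) ch h0
      (by rw [h1]; module) bh nh ph
    obtain ⟨η, ηt, ηl, ηc, ηr⟩ := exists_trajectory (p := P₀.B) (q := P₁.B) (Or.inr rfl) cg g0
      (by rw [g1]; module) bg ng pg
    refine ⟨⟨ξ, η⟩, fun t => ?_, ?_, ξc, ηc, 3, _, isSubdivision_of_le huv, fun i => ?_⟩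
    · have := ha t
      rw [s₁] at this
      rw [Placement.Compatible, dist_eq_norm, Motion.placementAt]
      simp only [ξt, ηt]
      refine this.trans_eq (congrArg _ ?_)
      module
    · refine le_trans ?_ vgh
      rw [add_comm]
      exact add_le_add ξl ηl
    · fin_cases i
      exacts [Or.inl (ξr _ _ ru), Or.inr (ηr _ _ rv),
        Or.inl (ξr _ _ rr)]
  · rw [hX] at h1 g1
    obtain ⟨ξ, ξt, ξl, ξc, ξr⟩ := exists_trajectory (p := P₀.A) (q := P₁.A) (Or.inl rfl) cg g0
      (by rw [g1]; module) bg ng pg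
    obtain ⟨η, ηt, ηl, ηc, ηr⟩ := exists_trajectory (p := P₀.B) (q := P₁.B) (Or.inr rfl) ch h0
      (by rw [h1]; module) bh nh ph
    refine ⟨⟨ξ, η⟩, fun t => ?_, ?_, ξc, ηc, 3, _, isSubdivision_of_le huv, fun i => ?_⟩
    · have := ha t
      rw [s₁] at this
      rw [Placement.Compatible, dist_eq_norm, Motion.placementAt]
      simp only [ξt, ηt]
      refine this.trans_eq (congrArg _ ?_)
      module
    · refine le_trans ?_ vgh
      rw [Motion.length]
      exact add_le_add ξl ηl
    · fin_cases i
      exacts [Or.inr (ηr _ _ ru), Or.inl (ξr _ _ rv),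
        Or.inr (ηr _ _ rr)]

/-! ### Lower bound: lengths from widths. -/

/-- The mean width formula for a segment. -/
lemma integral_abs_hdot (Z : Plane) (x : ℝ) : ∫ θ in x..x + π, |hdot Z θ| = 2 * ‖Z‖ := by
  obtain ⟨n, -, -, hn⟩ := exists_polar Z 0
  have h1 : (fun θ => |hdot Z θ|) = fun θ => ‖Z‖ * |cos (θ - n)| := by
    ext θ
    conv_lhs => rw [hn]
    rw [hdot_smul, hdot_uvec, abs_mul, abs_norm]
  have hper : Function.Periodic (fun θ => |cos θ|) π := fun θ => by
    simp [cos_add_pi]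
  have h2 : ∫ θ in (-(π / 2))..-(π / 2) + π, |cos θ| = 2 := by
    have : ∫ θ in (-(π / 2))..-(π / 2) + π, |cos θ| = ∫ θ in (-(π / 2))..(π / 2), cos θ := by
      rw [show -(π / 2) + π = π / 2 by ring]
      apply intervalIntegral.integral_congr
      intro θ hθ
      rw [uIcc_of_le (by linarith [pi_pos])] at hθ
      exact abs_of_nonneg (cos_nonneg_of_mem_Icc hθ)
    rw [this, integral_cos, sin_neg, sin_pi_div_two]; norm_num
  rw [h1, intervalIntegral.integral_const_mul,
    intervalIntegral.integral_comp_sub_right (fun θ => |cos θ|),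
    show x + π - n = x - n + π by ring, hper.intervalIntegral_add_eq _ (-(π / 2)), h2, mul_comm]

/-- Closing the walk by a step from `u n` back to `u 0` gives a closed walk, which covers the
interval between any two of its values at least twice. -/
lemma two_mul_sub_le_sum_abs (u : ℕ → ℝ) {n j k : ℕ} (hj : j ≤ n) (hk : k ≤ n) :
    2 * (u j - u k) - |u n - u 0| ≤ ∑ i ∈ Finset.range n, |u (i + 1) - u i| := by
  have key : ∀ j k, j ≤ k → k ≤ n →
      2 * |u j - u k| - |u n - u 0| ≤ ∑ i ∈ Finset.range n, |u (i + 1) - u i| := by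
    intro j k hjk hk
    have h := fun {p q : ℕ} (hpq : p ≤ q) => dist_le_Ico_sum_dist u hpq
    have e : ∑ i ∈ Finset.range n, |u (i + 1) - u i|
        = ∑ i ∈ Finset.Ico 0 n, dist (u i) (u (i + 1)) := by
      rw [Finset.range_eq_Ico]
      exact Finset.sum_congr rfl fun i _ => by rw [dist_comm, Real.dist_eq]
    rw [e, ← Finset.sum_Ico_consecutive _ (Nat.zero_le j) (hjk.trans hk),
      ← Finset.sum_Ico_consecutive _ hjk hk]
    have h1 := h (Nat.zero_le j)
    have h2 := h hjk
    have h3 := h hk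
    rw [Real.dist_eq] at h1 h2 h3
    have h4 : |u j - u k| ≤ |u 0 - u j| + |u k - u n| + |u n - u 0| := by
      have e : u j - u k = -(u 0 - u j) + -(u k - u n) + -(u n - u 0) := by ring
      rw [e]
      refine (abs_add_three _ _ _).trans ?_
      rw [abs_neg, abs_neg, abs_neg]
    linarith
  rcases le_total j k with h | h
  · linarith [key j k h hk, le_abs_self (u j - u k)]
  · linarith [key k j h hj, neg_le_abs (u k - u j)]

/-- The widths of a rectifiable curve are dominated, up to an arbitrarily small error, by a
function whose mean is at most the length of the curve. -/
lemma exists_width_bound {f : I → Plane} (hf : Continuous f) (hv : BoundedVariationOn f univ)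
    {ω : ℝ} (hω : 0 < ω) :
    ∃ F : ℝ → ℝ, Continuous F ∧
      (∀ x, ∫ θ in x..x + π, F θ ≤ 2 * (eVariationOn f univ).toReal) ∧
      ∀ θ t t', 2 * hdot (f t - f t') θ - |hdot (f 1 - f 0) θ| ≤ F θ + ω := by
  -- Two times are approximated by nodes, and their difference is doubled, so `ω / 4` adds up to
  -- `ω`.
  obtain ⟨δ, hδ, huc⟩ := Metric.uniformContinuous_iff.1
    (CompactSpace.uniformContinuous_of_continuous hf) (ω / 4) (by positivity)
  obtain ⟨n, hn⟩ := exists_nat_gt (1 / δ)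
  have hn0 : (0 : ℝ) < n := (by positivity : 0 < 1 / δ).trans hn
  have hnδ : 1 / (n : ℝ) < δ := by
    rw [div_lt_iff₀ hn0]; rw [div_lt_iff₀ hδ] at hn; linarith
  set p : ℕ → I := fun i => projIcc 0 1 zero_le_one ((i : ℝ) / n) with hp
  have p0 : p 0 = 0 := projIcc_of_le_left _ (by simp)
  have pn : p n = 1 := projIcc_of_right_le _ (by rw [div_self hn0.ne'])
  have hpm : Monotone p := fun i j hij => monotone_projIcc _ (by
    have : (i : ℝ) ≤ j := by exact_mod_cast hij
    gcongr)
  have happ : ∀ t : I, ∃ j ≤ n, dist (f t) (f (p j)) < ω / 4 := by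
    intro t
    have ht : 0 ≤ (t : ℝ) * n := mul_nonneg t.2.1 hn0.le
    have h1 := Nat.floor_le ht
    have h2 := Nat.lt_floor_add_one ((t : ℝ) * n)
    have hle : (t : ℝ) * n ≤ n := mul_le_of_le_one_left hn0.le t.2.2
    refine ⟨⌊(t : ℝ) * n⌋₊, Nat.floor_le_of_le hle, huc ?_⟩
    have h3 : ((⌊(t : ℝ) * n⌋₊ : ℝ) / n) ∈ Icc (0 : ℝ) 1 :=
      ⟨by positivity, (div_le_one hn0).2 (h1.trans hle)⟩
    simp only [hp]
    rw [projIcc_of_mem _ h3, Subtype.dist_eq, Real.dist_eq]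
    refine lt_of_le_of_lt ?_ hnδ
    have e : (t : ℝ) - ⌊(t : ℝ) * n⌋₊ / n = ((t : ℝ) * n - ⌊(t : ℝ) * n⌋₊) / n := by field_simp
    rw [e, abs_of_nonneg (div_nonneg (by linarith) hn0.le)]
    exact div_le_div_of_nonneg_right (by linarith) hn0.le
  refine ⟨fun θ => ∑ i ∈ Finset.range n, |hdot (f (p (i + 1)) - f (p i)) θ|,
    continuous_finsetSum _ fun i _ => (continuous_hdot _).abs, fun x => ?_, fun θ t t' => ?_⟩
  · rw [intervalIntegral.integral_finsetSum
      fun i _ => (continuous_hdot _).abs.intervalIntegrable _ _]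
    simp only [integral_abs_hdot]
    rw [← Finset.mul_sum]
    refine mul_le_mul_of_nonneg_left ?_ zero_le_two
    rw [← ENNReal.ofReal_le_iff_le_toReal hv, ENNReal.ofReal_sum_of_nonneg fun _ _ => norm_nonneg _]
    simp only [← dist_eq_norm, ← edist_dist]
    exact eVariationOn.sum_le hpm fun _ => mem_univ _
  · obtain ⟨j, hj, hdj⟩ := happ t
    obtain ⟨k, hk, hdk⟩ := happ t'
    have h := two_mul_sub_le_sum_abs (fun i => hdot (f (p i)) θ) hj hk
    simp only [← hdot_sub, p0, pn] at h
    have h1 := hdot_le (f t - f (p j)) θ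
    have h2 := hdot_le (f (p k) - f t') θ
    rw [← dist_eq_norm] at h1 h2
    rw [dist_comm] at h2
    simp only [hdot_sub] at h h1 h2 ⊢
    linarith

/-- A lower bound for the total length of two curves in terms of the sum of their widths. -/
lemma integral_le_length_add_length {f g : I → Plane} (hf : Continuous f) (hg : Continuous g)
    (hfv : BoundedVariationOn f univ) (hgv : BoundedVariationOn g univ) {G : ℝ → ℝ}
    (hG : Continuous G) {x : ℝ}
    (h : ∀ θ ∈ Icc x (x + π), ∃ t t' u u', G θ ≤ 2 * hdot (f t - f t') θ - |hdot (f 1 - f 0) θ|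
      + (2 * hdot (g u - g u') θ - |hdot (g 1 - g 0) θ|)) :
    ∫ θ in x..x + π, G θ ≤ 2 * ((eVariationOn f univ).toReal + (eVariationOn g univ).toReal) := by
  refine le_of_forall_pos_le_add fun ε hε => ?_
  have hω : 0 < ε / (2 * π) := div_pos hε two_pi_pos
  obtain ⟨F, hF, hFi, hFb⟩ := exists_width_bound hf hfv hω
  obtain ⟨K, hK, hKi, hKb⟩ := exists_width_bound hg hgv hω
  have hFK : Continuous fun θ => F θ + K θ := hF.add hK
  have hle : ∫ θ in x..x + π, G θ ≤ ∫ θ in x..x + π, (F θ + K θ + ε / π) := by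
    refine intervalIntegral.integral_mono_on (by linarith [pi_pos]) (hG.intervalIntegrable _ _)
      ((hFK.add continuous_const).intervalIntegrable _ _) fun θ hθ => ?_
    obtain ⟨t, t', u, u', hb⟩ := h θ hθ
    have e : ε / π = ε / (2 * π) + ε / (2 * π) := by field_simp; ring
    linarith [hFb θ t t', hKb θ u u']
  rw [intervalIntegral.integral_add (hFK.intervalIntegrable _ _)
    (continuous_const.intervalIntegrable _ _), intervalIntegral.integral_add
    (hF.intervalIntegrable _ _) (hK.intervalIntegrable _ _), intervalIntegral.integral_const,
    add_sub_cancel_left, smul_eq_mul, mul_div_cancel₀ _ pi_ne_zero] at hle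
  linarith [hFi x, hKi x]

lemma le_supp_of_end (P a b : Plane) (θ : ℝ) : hdot (P + a + b) θ ≤ supp P a b θ := by
  simp only [supp, hdot_add]
  linarith [le_max_left (hdot a θ) 0, le_max_left (hdot b θ) 0]

lemma le_supp_of_start (P a b : Plane) (θ : ℝ) : hdot P θ ≤ supp P a b θ := by
  simp only [supp]
  linarith [le_max_right (hdot a θ) 0, le_max_right (hdot b θ) 0]

/-- A pair of curves whose sum turns through all directions between `x` and `y` while staying
outside the disc of radius `s` has at least the length given by the excess integral. -/
theorem add_integral_excess_le {s x y : ℝ} {P : Plane} {f g : I → Plane} (hf : Continuous f)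
    (hg : Continuous g) (hfv : BoundedVariationOn f univ) (hgv : BoundedVariationOn g univ)
    (hxy : x ≤ y) (hy : y ≤ x + 2 * π) (hend : s ≤ supp P (f 1 - f 0) (g 1 - g 0) y)
    (hcov : ∀ θ ∈ Icc x y, ∃ t, s ≤ hdot (P + (f t - f 0) + (g t - g 0)) θ) :
    ‖f 1 - f 0‖ + ‖g 1 - g 0‖ + ∫ θ in x..y, excess s P (f 1 - f 0) (g 1 - g 0) θ
      ≤ (eVariationOn f univ).toReal + (eVariationOn g univ).toReal := by
  set a := f 1 - f 0 with ha
  set b := g 1 - g 0 with hb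
  -- By `hend` the excess vanishes at `y`, so freezing it there extends it continuously by zero to
  -- the rest of the full turn.
  set e : ℝ → ℝ := fun θ => excess s P a b (min θ y) with he
  have hec : Continuous e := (continuous_excess s P a b).comp (by fun_prop)
  have he0 : ∀ θ, 0 ≤ e θ := fun θ => excess_nonneg _ _ _ _ _
  have key : ∀ θ, x ≤ θ → ∃ t u,
      max (hdot a θ) 0 + max (hdot b θ) 0 + e θ ≤ hdot (f t - f 0) θ + hdot (g u - g 0) θ := by
    intro θ hθ
    by_cases hpos : e θ = 0
    · have hmax : ∀ k : I → Plane, ∃ t, max (hdot (k 1 - k 0) θ) 0 ≤ hdot (k t - k 0) θ := by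
        intro k
        rcases le_total (hdot (k 1 - k 0) θ) 0 with h | h
        · exact ⟨0, by rw [max_eq_right h]; simp⟩
        · exact ⟨1, by rw [max_eq_left h]⟩
      obtain ⟨t, ht⟩ := hmax f
      obtain ⟨u, hu⟩ := hmax g
      exact ⟨t, u, by rw [hpos]; linarith⟩
    · have hθy : θ < y := by
        by_contra! h
        apply hpos
        simp only [he, excess]
        rw [min_eq_right h]
        exact max_eq_right (by linarith)
      obtain ⟨t, ht⟩ := hcov θ ⟨hθ, hθy.le⟩
      refine ⟨t, t, ?_⟩
      have h1 : e θ = s - supp P a b θ := by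
        simp only [he, excess] at hpos ⊢
        rw [min_eq_left hθy.le] at hpos ⊢
        rcases max_choice (s - supp P a b θ) 0 with h | h
        · exact h
        · exact absurd h hpos
      rw [h1, supp]
      rw [hdot_add, hdot_add] at ht
      linarith
  have hcab : Continuous fun θ => |hdot a θ| + |hdot b θ| :=
    (continuous_hdot a).abs.add (continuous_hdot b).abs
  have hce : Continuous fun θ => e (θ + π) := hec.comp (by fun_prop)
  have hcee : Continuous fun θ => 2 * (e θ + e (θ + π)) := continuous_const.mul (hec.add hce)
  -- Opposite directions are paired: `key` at `θ` and at `θ + π` bounds the sum of the two widths by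
  -- the chord widths plus both excesses. Over a half turn this collects the excess of a full turn.
  have hmain := integral_le_length_add_length hf hg hfv hgv (x := x)
    (G := fun θ => |hdot a θ| + |hdot b θ| + 2 * (e θ + e (θ + π)))
    (hcab.add hcee) fun θ hθ => by
    obtain ⟨t, u, h1⟩ := key θ hθ.1
    obtain ⟨t', u', h2⟩ := key (θ + π) (by linarith [hθ.1, pi_pos])
    refine ⟨t, t', u, u', ?_⟩
    rw [hdot_add_pi, hdot_add_pi, hdot_add_pi, hdot_add_pi] at h2
    have habs : ∀ z : ℝ, |z| = max z 0 + max (-z) 0 := fun z => by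
      rcases le_total 0 z with h | h
      · rw [abs_of_nonneg h, max_eq_left h, max_eq_right (by linarith)]; ring
      · rw [abs_of_nonpos h, max_eq_right h, max_eq_left (by linarith)]; ring
    have h3 := habs (hdot a θ)
    have h4 := habs (hdot b θ)
    rw [hdot_sub (f t), hdot_sub (g u)] at h1
    rw [hdot_sub (f t'), hdot_sub (g u')] at h2
    rw [← ha, ← hb, hdot_sub (f t), hdot_sub (g u)]
    linarith
  have i1 : ∀ c d, IntervalIntegrable e MeasureTheory.volume c d :=
    fun c d => hec.intervalIntegrable c d
  rw [intervalIntegral.integral_add (hcab.intervalIntegrable _ _) (hcee.intervalIntegrable _ _),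
    intervalIntegral.integral_add ((continuous_hdot a).abs.intervalIntegrable _ _)
      ((continuous_hdot b).abs.intervalIntegrable _ _), intervalIntegral.integral_const_mul,
    intervalIntegral.integral_add (i1 _ _) (hce.intervalIntegrable _ _),
    integral_abs_hdot, integral_abs_hdot, intervalIntegral.integral_comp_add_right e,
    intervalIntegral.integral_add_adjacent_intervals (i1 _ _) (i1 _ _)] at hmain
  have hsub : ∫ θ in x..y, excess s P a b θ ≤ ∫ θ in x..x + π + π, e θ := by
    have h1 : ∫ θ in x..y, excess s P a b θ = ∫ θ in x..y, e θ := by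
      apply intervalIntegral.integral_congr
      intro θ hθ
      rw [uIcc_of_le hxy] at hθ
      simp only [he]
      rw [min_eq_left hθ.2]
    rw [h1]
    exact intervalIntegral.integral_mono_interval le_rfl hxy (by linarith)
      (Filter.Eventually.of_forall he0) (i1 _ _)
  linarith

/-! ### Every compatible motion turns one way or the other. -/

/-- A curve that avoids the origin turns counter-clockwise or clockwise through all directions
between the directions of its end points. -/
lemma turns_through {D : I → Plane} (hD : Continuous D) (hD0 : ∀ t, D t ≠ 0) {θ₀ θ₁ : ℝ}
    (h0 : D 0 = ‖D 0‖ • uvec θ₀) (h1 : D 1 = ‖D 1‖ • uvec θ₁) (h01 : θ₀ ≤ θ₁) :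
    (∀ θ ∈ Icc θ₀ θ₁, ∃ t, D t = ‖D t‖ • uvec θ) ∨
      ∀ θ ∈ Icc θ₁ (θ₀ + 2 * π), ∃ t, D t = ‖D t‖ • uvec θ := by
  by_contra! hcon
  obtain ⟨⟨θ, hθ, hm⟩, β, hβ, hb⟩ := hcon
  have hβ1 : θ₁ < β := lt_of_le_of_ne hβ.1 fun h => hb 1 (h ▸ h1)
  have hβ0 : β < θ₀ + 2 * π := lt_of_le_of_ne hβ.2 fun h => hb 0 (by
    rw [h, uvec, cos_add_two_pi, sin_add_two_pi]; exact h0)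
  -- If some direction is missed on each side, rotate the missed `β` onto the negative real axis.
  -- The argument is then continuous along the curve and, by the intermediate value theorem, attains
  -- the other missed direction.
  set z : I → ℂ := fun t => ⟨hdot (D t) (β - π), vdot (D t) (β - π)⟩ with hz
  have hzn : ∀ t, ‖z t‖ = ‖D t‖ := fun t => by
    have : ‖z t‖ ^ 2 = ‖D t‖ ^ 2 := by
      rw [norm_sq_eq_dots _ (β - π), ← Complex.normSq_eq_norm_sq, Complex.normSq_apply]; ring
    exact (pow_left_inj₀ (norm_nonneg _) (norm_nonneg _) two_ne_zero).1 this
  have hpol : ∀ t α, (z t).arg = α → D t = ‖D t‖ • uvec (α + (β - π)) := fun t α hα => by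
    apply ext_dots (β - π)
    · have := Complex.norm_mul_cos_arg (z t)
      rw [hα, hzn] at this
      rw [hdot_smul, hdot_uvec, ← cos_neg, show -(β - π - (α + (β - π))) = α by ring, this]
    · have := Complex.norm_mul_sin_arg (z t)
      rw [hα, hzn] at this
      rw [vdot_smul, vdot_uvec, ← sin_neg, show -(β - π - (α + (β - π))) = α by ring, this]
  have hslit : ∀ t, z t ∈ Complex.slitPlane := fun t => by
    rw [Complex.mem_slitPlane_iff_arg]
    refine ⟨fun h => hb t ?_, fun h => hD0 t ?_⟩
    · have := hpol t π h
      rwa [add_sub_cancel] at this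
    · rw [← norm_eq_zero, ← hzn, h, norm_zero]
  have hzc : Continuous z := by
    have e : z = fun t => (hdot (D t) (β - π) : ℂ) + (vdot (D t) (β - π) : ℂ) * Complex.I := by
      ext t; exact Complex.mk_eq_add_mul_I _ _
    rw [e]
    unfold hdot vdot
    fun_prop
  have harg : Continuous fun t => (z t).arg := by
    rw [continuous_iff_continuousAt]
    exact fun t => (Complex.continuousAt_arg (hslit t)).comp hzc.continuousAt
  have hval : ∀ t φ, D t = ‖D t‖ • uvec φ → θ₀ ≤ φ → φ ≤ θ₁ → (z t).arg = φ - (β - π) := by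
    intro t φ h h2 h3
    have e : z t = ((‖D t‖ : ℝ) : ℂ) * (Complex.cos ((φ - (β - π) : ℝ))
        + Complex.sin ((φ - (β - π) : ℝ)) * Complex.I) := by
      apply Complex.ext
      · simp only [hz]
        conv_lhs => rw [h]
        rw [hdot_smul, hdot_uvec, ← cos_neg, neg_sub]
        generalize φ - (β - π) = ψ
        simp only [Complex.re_ofReal_mul, ← Complex.ofReal_cos,
          ← Complex.ofReal_sin]
        simp [-Complex.ofReal_cos, -Complex.ofReal_sin]
      · simp only [hz]
        conv_lhs => rw [h]
        rw [vdot_smul, vdot_uvec, ← sin_neg, neg_sub]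
        generalize φ - (β - π) = ψ
        simp only [Complex.im_ofReal_mul, ← Complex.ofReal_cos,
          ← Complex.ofReal_sin]
        simp [-Complex.ofReal_cos, -Complex.ofReal_sin]
    rw [e]
    exact Complex.arg_mul_cos_add_sin_mul_I (norm_pos_iff.2 (hD0 t)) ⟨by linarith, by linarith⟩
  obtain ⟨t, -, ht⟩ := intermediate_value_Icc (zero_le_one' I) harg.continuousOn
    (show θ - (β - π) ∈ Icc (z 0).arg (z 1).arg by
      rw [hval 0 θ₀ h0 le_rfl h01, hval 1 θ₁ h1 h01 le_rfl]
      exact ⟨by linarith [hθ.1], by linarith [hθ.2]⟩)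
  have := hpol t _ ht
  rw [sub_add_cancel] at this
  exact hm t this

/-- Negating the second trajectory turns the difference of the centres into a sum of two curves,
without increasing length. -/
lemma le_length_of_turns {s x y : ℝ} {P₀ P₁ : Placement} {m : Motion P₀ P₁}
    (hm : m.Compatible s) (hxy : x ≤ y) (hy : y ≤ x + 2 * π)
    (hend : s ≤ supp (P₀.A - P₀.B) (P₁.A - P₀.A) (P₀.B - P₁.B) y)
    (hturn : ∀ θ ∈ Icc x y, ∃ t, m.trajA.toPath t - m.trajB.toPath t
      = ‖m.trajA.toPath t - m.trajB.toPath t‖ • uvec θ) :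
    ENNReal.ofReal (‖P₁.A - P₀.A‖ + ‖P₀.B - P₁.B‖
      + ∫ θ in x..y, excess s (P₀.A - P₀.B) (P₁.A - P₀.A) (P₀.B - P₁.B) θ) ≤ m.length := by
  set f : I → Plane := fun t => m.trajA.toPath t with hf
  set g : I → Plane := fun t => -m.trajB.toPath t with hg
  have ha : f 1 - f 0 = P₁.A - P₀.A := by simp [hf]
  have hb : g 1 - g 0 = P₀.B - P₁.B := by simp [hg]; abel
  have hgl : eVariationOn g univ ≤ m.trajB.length :=
    eVariationOn_transform_le (m := id) (ε := -1) (w := 0) (Or.inr rfl) monotone_id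
      fun t _ => by simp [hg]
  have hfv : eVariationOn f univ ≠ ⊤ := m.trajA.rectifiable
  have hgv : eVariationOn g univ ≠ ⊤ := ne_top_of_le_ne_top m.trajB.rectifiable hgl
  have h := add_integral_excess_le (s := s) (P := P₀.A - P₀.B) (f := f) (g := g)
    m.trajA.toPath.continuous m.trajB.toPath.continuous.neg hfv hgv hxy hy
    (by rwa [ha, hb]) fun θ hθ => by
      obtain ⟨t, ht⟩ := hturn θ hθ
      refine ⟨t, ?_⟩
      have e : P₀.A - P₀.B + (f t - f 0) + (g t - g 0) = f t - m.trajB.toPath t := by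
        simp [hf, hg]; abel
      rw [e, ht, hdot_smul, hdot_uvec_self, mul_one, ← dist_eq_norm]
      exact hm t
  rw [ha, hb] at h
  calc _ ≤ ENNReal.ofReal ((eVariationOn f univ).toReal + (eVariationOn g univ).toReal) :=
        ENNReal.ofReal_le_ofReal h
    _ = eVariationOn f univ + eVariationOn g univ := by
        rw [ENNReal.ofReal_add ENNReal.toReal_nonneg ENNReal.toReal_nonneg,
          ENNReal.ofReal_toReal hfv, ENNReal.ofReal_toReal hgv]
    _ ≤ m.length := add_le_add le_rfl hgl

end TwoDiscs

end

theorem theorem4p1 (s : ℝ) (hs : 0 < s) (P₀ P₁ : TwoDiscs.Placement)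
    (h₀ : P₀.Compatible s) (h₁ : P₁.Compatible s) :
    ∃ m : TwoDiscs.Motion P₀ P₁,
      m.IsShortest s ∧
      m.trajA.ComposedOfAtMost s 6 ∧
      m.trajB.ComposedOfAtMost s 6 ∧
      m.Decoupled := by
  have hPs : s ≤ ‖P₀.A - P₀.B‖ := by rw [← dist_eq_norm]; exact h₀
  have hQs : s ≤ ‖P₁.A - P₁.B‖ := by rw [← dist_eq_norm]; exact h₁
  have hQe : P₀.A - P₀.B + (P₁.A - P₀.A) + (P₀.B - P₁.B) = P₁.A - P₁.B := by abel
  obtain ⟨θ₀, -, -, hP⟩ := TwoDiscs.exists_polar (P₀.A - P₀.B) 0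
  obtain ⟨θ₁, h01, h10, hQ⟩ := TwoDiscs.exists_polar (P₁.A - P₁.B) θ₀
  obtain ⟨ℓ, hℓ, hℓ₁, hℓ₂⟩ := TwoDiscs.Schedule.exists (a := P₁.A - P₀.A) (b := P₀.B - P₁.B)
    hs hP (by rwa [hQe]) hPs (by rwa [hQe]) h01 h10.le
  obtain ⟨m, hm, hml, hA, hB, hd⟩ := hℓ.exists_motion
  refine ⟨m, ⟨hm, fun m' hm' => hml.trans ?_⟩, hA, hB, hd⟩
  have hne : ∀ t, m'.trajA.toPath t - m'.trajB.toPath t ≠ 0 := fun t => by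
    rw [← norm_pos_iff, ← dist_eq_norm]
    exact hs.trans_le (hm' t)
  have hcont : Continuous fun t => m'.trajA.toPath t - m'.trajB.toPath t :=
    m'.trajA.toPath.continuous.sub m'.trajB.toPath.continuous
  -- `ℓ` is at most the bound for either way of turning, so it does not matter which one the
  -- competitor takes.
  rcases TwoDiscs.turns_through hcont hne (θ₀ := θ₀) (θ₁ := θ₁) (by simpa using hP)
    (by simpa using hQ) h01 with h | h
  · refine (ENNReal.ofReal_le_ofReal hℓ₁).trans
      (TwoDiscs.le_length_of_turns hm' h01 h10.le ?_ h)
    refine le_trans ?_ (TwoDiscs.le_supp_of_end _ _ _ _)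
    rw [hQe, hQ, TwoDiscs.hdot_smul, TwoDiscs.hdot_uvec_self, mul_one]
    exact hQs
  · refine (ENNReal.ofReal_le_ofReal hℓ₂).trans
      (TwoDiscs.le_length_of_turns hm' h10.le (by linarith) ?_ h)
    refine le_trans ?_ (TwoDiscs.le_supp_of_start _ _ _ _)
    rw [TwoDiscs.hdot_add_two_pi, hP, TwoDiscs.hdot_smul, TwoDiscs.hdot_uvec_self, mul_one]
    exact hPs
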